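/- Let $n\ge 1$ and $\mathbb S=\mathbb C[q,q^{-1}]$, with $q$ an indeterminate. All algebras are associative $\mathbb S$-algebras with unit, and all tensor products are over $\mathbb S$. For $m\ge 1$, the Iwahori--Hecke algebra $H_m=H_m(q)$ is presented by generators $h_1,\dots,h_{m-1}$ and relations $h_ih_jh_i=h_jh_ih_j$ for $|i-j|=1$, $h_ih_j=h_jh_i$ for $|i-j|>1$, and $h_i^2=1+(q-q^{-1})h_i$. The tied--boxed Hecke algebra $bH_n(q)$ is presented by generators $e_1,\dots,e_{n-1},z_1,\dots,z_{n-1}$ and relations $e_i^2=e_i$ and $e_ie_j=e_je_i$; $z_iz_jz_i=z_jz_iz_j$ for $|i-j|=1$; $z_iz_j=z_jz_i$ for $|i-j|>1$; $e_iz_i=z_i$ and $e_iz_j=z_je_i$ for all $i,j$; and $z_i^2=e_i+(q-q^{-1})z_i$. If $s_{i_1}\cdots s_{i_r}$ is a reduced expression of a permutation $w$, put $h_w=h_{i_1}\cdots h_{i_r}$ and $z_w=z_{i_1}\cdots z_{i_r}$. Let $\mathcal{LP}_n$ be the set of linear set partitions of $[n]=\{1,\dots,n\}$, that is, those whose blocks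 are intervals. Write $\mathbf I\preceq\mathbf J$ if $\mathbf I$ is finer than $\mathbf J$, $|\mathbf I|$ for the number of blocks, and $\|\mathbf I\|$ for the sequence of block sizes, the blocks being ordered by their least elements. Let $\mathcal C_n$ be the set of compositions of $n$ with positive parts. For $\mathbf I\in\mathcal{LP}_n$ put $$E_{\mathbf I}=\prod_{i\sim_{\mathbf I}i+1}e_i,\qquad \mathbb E_{\mathbf I}=\sum_{\mathbf J\succeq\mathbf I}(-1)^{|\mathbf I|-|\mathbf J|}E_{\mathbf J}\in bH_n(q).$$ For $\mu=(\mu_1,\dots,\mu_k)\in\mathcal C_n$ let $\mathfrak S_\mu\le\mathfrak S_n$ be the Young subgroup, which preserves each of the consecutive intervals of sizes $\mu_1,\dots,\mu_k$, and let $H_\mu$ be the subalgebra of $H_n$ generated by the $h_i$ with $s_i\in\mathfrak S_\mu$. An element $w\in\mathfrak S_\mu$ is written $w=w_1\cdots w_k$, where $w_j\in\mathfrak S_{\mu_j}$ acts on the $j$-th interval. Then $\mathbf I\mapsto\|\mathbf I\|$ is a bijection $\mathcal{LP}_n\to\mathcal C_n$, and the $\mathbb E_{\mathbf I}$, $\mathbf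 I\in\mathcal{LP}_n$, form a complete set of central orthogonal idempotents of $bH_n(q)$. Let $\mathbf I\in\mathcal{LP}_n$, let $\mu=(\mu_1,\dots,\mu_k)=\|\mathbf I\|$, and let $bH_n(q)^\mu=\mathbb E_{\mathbf I}\,bH_n(q)$, an algebra with unit $\mathbb E_{\mathbf I}$. Then: 1. There is a unique $\mathbb S$-linear map $\Phi_{\mathbf I}:bH_n(q)^\mu\to H_\mu$ with $\mathbb E_{\mathbf I}z_w\mapsto h_w$ for every $w\in\mathfrak S_\mu$ and every choice of reduced expression of $w$, and it is an isomorphism of $\mathbb S$-algebras. 2. There is an isomorphism of $\mathbb S$-algebras $\Psi_\mu:H_\mu\to H_{\mu_1}\otimes\cdots\otimes H_{\mu_k}$ with $h_w\mapsto h_{w_1}\otimes\cdots\otimes h_{w_k}$ for all $w=w_1\cdots w_k\in\mathfrak S_\mu$ and all choices of reduced expressions of $w,w_1,\dots,w_k$. In particular $bH_n(q)^\mu\simeq H_{\mu_1}\otimes\cdots\otimes H_{\mu_k}$. 3. $bH_n(q)^\mu$ is a free $\mathbb S$-module of rank $\mu_1!\cdots\mu_k!$. Hence there is an isomorphism of $\mathbb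 S$-algebras $$bH_n(q)\;\simeq\;\bigoplus_{(\mu_1,\dots,\mu_k)\in\mathcal C_n}H_{\mu_1}\otimes\cdots\otimes H_{\mu_k},$$ whose component at $\mu=\|\mathbf I\|$ is $x\mapsto\Psi_\mu(\Phi_{\mathbf I}(\mathbb E_{\mathbf I}x))$. -/

import Mathlib

open scoped TensorProduct BigOperators Nat

noncomputable section

namespace TiedBoxed

/-- The ground ring `ℂ[q, q⁻¹]` of Laurent polynomials in an indeterminate `q`. -/
abbrev GroundRing : Type := LaurentPolynomial ℂ

/-- The element `q - q⁻¹` of the ground ring. -/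
def qDiff : GroundRing := LaurentPolynomial.T 1 - LaurentPolynomial.T (-1)

/-- `|i - j| = 1`. -/
def Adjacent {m : ℕ} (i j : Fin m) : Prop := (i : ℕ) + 1 = j ∨ (j : ℕ) + 1 = i

/-- `|i - j| > 1`. -/
def Distant {m : ℕ} (i j : Fin m) : Prop := (i : ℕ) + 1 < j ∨ (j : ℕ) + 1 < i

/-! ### The Iwahori-Hecke algebra

The generators are indexed by `Fin (n - 1)`, which is a zero-based version of `[n - 1]`. -/

/-- The defining relations of the Iwahori-Hecke algebra. -/
inductive HeckeRel (n : ℕ) :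
    FreeAlgebra GroundRing (Fin (n - 1)) → FreeAlgebra GroundRing (Fin (n - 1)) → Prop
  | braid (i j : Fin (n - 1)) (h : Adjacent i j) :
      HeckeRel n
        (FreeAlgebra.ι GroundRing i * FreeAlgebra.ι GroundRing j * FreeAlgebra.ι GroundRing i)
        (FreeAlgebra.ι GroundRing j * FreeAlgebra.ι GroundRing i * FreeAlgebra.ι GroundRing j)
  | comm (i j : Fin (n - 1)) (h : Distant i j) :
      HeckeRel n
        (FreeAlgebra.ι GroundRing i * FreeAlgebra.ι GroundRing j)
        (FreeAlgebra.ι GroundRing j * FreeAlgebra.ι GroundRing i)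
  | quad (i : Fin (n - 1)) :
      HeckeRel n
        (FreeAlgebra.ι GroundRing i * FreeAlgebra.ι GroundRing i)
        (1 + qDiff • FreeAlgebra.ι GroundRing i)

/-- The Iwahori-Hecke algebra `H_n(q)`. -/
def Hecke (n : ℕ) : Type := RingQuot (HeckeRel n)

instance (n : ℕ) : Ring (Hecke n) := inferInstanceAs (Ring (RingQuot (HeckeRel n)))

instance (n : ℕ) : Algebra GroundRing (Hecke n) :=
  inferInstanceAs (Algebra GroundRing (RingQuot (HeckeRel n)))

/-- The generator `h_i` of `H_n(q)`. -/
def Hecke.h {n : ℕ} (i : Fin (n - 1)) : Hecke n :=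
  RingQuot.mkAlgHom GroundRing (HeckeRel n) (FreeAlgebra.ι GroundRing i)

/-! ### The tied-boxed Hecke algebra -/

/-- The generators `e_1, …, e_{n-1}, z_1, …, z_{n-1}`. -/
inductive Gen (n : ℕ) : Type
  | e (i : Fin (n - 1)) : Gen n
  | z (i : Fin (n - 1)) : Gen n

/-- The free generator `e_i`. -/
def freeE {n : ℕ} (i : Fin (n - 1)) : FreeAlgebra GroundRing (Gen n) :=
  FreeAlgebra.ι GroundRing (Gen.e i)

/-- The free generator `z_i`. -/
def freeZ {n : ℕ} (i : Fin (n - 1)) : FreeAlgebra GroundRing (Gen n) :=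
  FreeAlgebra.ι GroundRing (Gen.z i)

/-- The defining relations of the tied-boxed Hecke algebra. -/
inductive BHeckeRel (n : ℕ) :
    FreeAlgebra GroundRing (Gen n) → FreeAlgebra GroundRing (Gen n) → Prop
  | e_idem (i : Fin (n - 1)) : BHeckeRel n (freeE i * freeE i) (freeE i)
  | e_comm (i j : Fin (n - 1)) : BHeckeRel n (freeE i * freeE j) (freeE j * freeE i)
  | braid (i j : Fin (n - 1)) (h : Adjacent i j) :
      BHeckeRel n (freeZ i * freeZ j * freeZ i) (freeZ j * freeZ i * freeZ j)
  | z_comm (i j : Fin (n - 1)) (h : Distant i j) :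
      BHeckeRel n (freeZ i * freeZ j) (freeZ j * freeZ i)
  | absorb (i : Fin (n - 1)) : BHeckeRel n (freeE i * freeZ i) (freeZ i)
  | ez_comm (i j : Fin (n - 1)) : BHeckeRel n (freeE i * freeZ j) (freeZ j * freeE i)
  | quad (i : Fin (n - 1)) : BHeckeRel n (freeZ i * freeZ i) (freeE i + qDiff • freeZ i)

/-- The tied-boxed Hecke algebra `bH_n(q)`. -/
def BHecke (n : ℕ) : Type := RingQuot (BHeckeRel n)

instance (n : ℕ) : Ring (BHecke n) := inferInstanceAs (Ring (RingQuot (BHeckeRel n)))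

instance (n : ℕ) : Algebra GroundRing (BHecke n) :=
  inferInstanceAs (Algebra GroundRing (RingQuot (BHeckeRel n)))

/-- The generator `e_i` of `bH_n(q)`. -/
def BHecke.e {n : ℕ} (i : Fin (n - 1)) : BHecke n :=
  RingQuot.mkAlgHom GroundRing (BHeckeRel n) (freeE i)

/-- The generator `z_i` of `bH_n(q)`. -/
def BHecke.z {n : ℕ} (i : Fin (n - 1)) : BHecke n :=
  RingQuot.mkAlgHom GroundRing (BHeckeRel n) (freeZ i)

/-! ### Words and reduced expressions in the symmetric group -/

/-- The position `i` in `[n]`, for `i` in `[n - 1]`. -/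
def left {n : ℕ} (i : Fin (n - 1)) : Fin n := ⟨i, by omega⟩

/-- The position `i + 1` in `[n]`, for `i` in `[n - 1]`. -/
def right {n : ℕ} (i : Fin (n - 1)) : Fin n := ⟨i + 1, by omega⟩

/-- The simple transposition `s_i`, which exchanges `i` and `i + 1`. -/
def simple {n : ℕ} (i : Fin (n - 1)) : Equiv.Perm (Fin n) := Equiv.swap (left i) (right i)

/-- `s_{i_1} ⋯ s_{i_r}` is a reduced expression of `w`: it equals `w`, and no expression of `w` as
a product of simple transpositions is shorter. -/
def IsReducedExpr {n : ℕ} (w : Equiv.Perm (Fin n)) (L : List (Fin (n - 1))) : Prop :=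
  (L.map simple).prod = w ∧
    ∀ L' : List (Fin (n - 1)), (L'.map simple).prod = w → L.length ≤ L'.length

/-- The product `h_{i_1} ⋯ h_{i_r}`; for a reduced expression of `w` this is `h_w`. -/
def Hecke.word {n : ℕ} (L : List (Fin (n - 1))) : Hecke n := (L.map Hecke.h).prod

/-- The product `z_{i_1} ⋯ z_{i_r}`; for a reduced expression of `w` this is `z_w`. -/
def BHecke.word {n : ℕ} (L : List (Fin (n - 1))) : BHecke n := (L.map BHecke.z).prod

/-! ### Linear set partitions

A set partition of `[n]` is given by the equivalence relation `i ∼ j`. -/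

/-- A linear set partition of `[n]`: a set partition whose blocks are intervals. -/
@[ext]
structure LinearSetPartition (n : ℕ) where
  /-- The relation of lying in the same block. -/
  rel : Setoid (Fin n)
  /-- Blocks are intervals. -/
  convex : ∀ i j k : Fin n, i ≤ j → j ≤ k → rel i k → rel i j

namespace LinearSetPartition

variable {n : ℕ}

theorem rel_injective : Function.Injective (rel : LinearSetPartition n → Setoid (Fin n)) :=
  fun _ _ h => LinearSetPartition.ext h

/-- `I ≤ J` if `I` is finer than `J`. -/
instance : PartialOrder (LinearSetPartition n) := PartialOrder.lift rel rel_injective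

instance : Finite (LinearSetPartition n) :=
  Finite.of_injective (fun I : LinearSetPartition n => (fun i j => I.rel i j)) (by
    intro I J h
    apply rel_injective
    ext i j
    exact iff_of_eq (congrFun (congrFun h i) j))

instance : Fintype (LinearSetPartition n) := Fintype.ofFinite _

/-- The number of blocks `|I|`. -/
def numBlocks (I : LinearSetPartition n) : ℕ := Nat.card (Quotient I.rel)

open Classical in
/-- The Möbius function. If `I ≤ J` then `|J| ≤ |I|`, so the subtraction is not truncated. -/
def mobius (I J : LinearSetPartition n) : ℤ :=
  if I ≤ J then (-1) ^ (I.numBlocks - J.numBlocks) else 0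

/-- `i` is the least element of its block. -/
def IsBlockMin (I : LinearSetPartition n) (i : Fin n) : Prop := ∀ j, I.rel i j → i ≤ j

open Classical in
/-- The sizes of the blocks, the blocks being listed by increasing least element. -/
def blockSizes (I : LinearSetPartition n) : List ℕ :=
  ((List.finRange n).filter (fun i => I.IsBlockMin i)).map (fun i => Nat.card {j // I.rel i j})

theorem blockSizes_pos (I : LinearSetPartition n) {b : ℕ} (hb : b ∈ I.blockSizes) : 0 < b := by
  obtain ⟨i, -, rfl⟩ := List.mem_map.1 hb
  have : Nonempty {j // I.rel i j} := ⟨⟨i, I.rel.refl i⟩⟩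
  exact Nat.card_pos

theorem blockSizes_sum (I : LinearSetPartition n) : I.blockSizes.sum = n := by
  classical
  have hmin : ∀ j : Fin n, ∃ i, I.IsBlockMin i ∧ I.rel i j := by
    intro j
    obtain ⟨i, hi, hle⟩ := Finset.exists_min_image
      (Finset.univ.filter (fun i => I.rel i j)) id ⟨j, by simp⟩
    simp only [Finset.mem_filter, Finset.mem_univ, true_and, id] at hi hle
    exact ⟨i, fun k hk => hle k (I.rel.trans (I.rel.symm hk) hi), hi⟩
  choose m hm hmj using hmin
  have huniq : ∀ i j, I.IsBlockMin i → (I.rel i j ↔ m j = i) := by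
    intro i j hi
    constructor
    · intro h
      have h' : I.rel i (m j) := I.rel.trans h (I.rel.symm (hmj j))
      exact le_antisymm (hm j i (I.rel.symm h')) (hi _ h')
    · rintro rfl
      exact hmj j
  have h1 : I.blockSizes.sum = ∑ i ∈ Finset.univ.filter (fun i => I.IsBlockMin i),
      Nat.card {j // I.rel i j} := by
    rw [blockSizes, ← List.sum_toFinset _ ((List.nodup_finRange n).filter _)]
    refine Finset.sum_congr ?_ (fun _ _ => rfl)
    ext i
    simp
  have h2 := Finset.card_eq_sum_card_fiberwise (s := (Finset.univ : Finset (Fin n))) (f := m)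
    (t := Finset.univ.filter (fun i => I.IsBlockMin i)) (by intro j _; simpa using hm j)
  rw [Finset.card_univ, Fintype.card_fin] at h2
  refine h1.trans (Eq.trans ?_ h2.symm)
  refine Finset.sum_congr rfl (fun i hi => ?_)
  have hi' : I.IsBlockMin i := by simpa using hi
  rw [Nat.card_eq_fintype_card, Fintype.card_subtype]
  congr 1
  ext j
  simp [huniq i j hi']

/-- The composition `‖I‖` of `n`, formed by the sizes of the blocks of `I`. -/
def type (I : LinearSetPartition n) : Composition n where
  blocks := I.blockSizes
  blocks_pos := I.blockSizes_pos
  blocks_sum := I.blockSizes_sum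

open Classical in
/-- The product `E_I` of those `e_i` for which `i` and `i + 1` lie in the same block of `I`. The
`e_i` commute, so the order of the factors is immaterial. -/
def E (I : LinearSetPartition n) : BHecke n :=
  (((List.finRange (n - 1)).filter (fun i => I.rel (left i) (right i))).map BHecke.e).prod

open Classical in
/-- The Möbius idempotent `𝔼_I`, the sum of `μ(I, J) E_J` over the `J` coarser than `I`. -/
def idem (I : LinearSetPartition n) : BHecke n :=
  ∑ J ∈ Finset.univ.filter (fun J => I ≤ J), I.mobius J • J.E

/-- The summand `𝔼_I bH_n(q)`, with the operations of `bH_n(q)`. It is closed under multiplication,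
but it does not contain the unit of `bH_n(q)` in general. -/
def summand (I : LinearSetPartition n) : NonUnitalSubalgebra GroundRing (BHecke n) where
  carrier := {y | ∃ x, y = I.idem * x}
  zero_mem' := ⟨0, by simp⟩
  add_mem' := by
    rintro _ _ ⟨x, rfl⟩ ⟨y, rfl⟩
    exact ⟨x + y, by rw [mul_add]⟩
  mul_mem' := by
    rintro _ _ ⟨x, rfl⟩ ⟨y, rfl⟩
    exact ⟨x * (I.idem * y), by rw [mul_assoc]⟩
  smul_mem' := by
    rintro c _ ⟨x, rfl⟩
    exact ⟨c • x, by rw [mul_smul_comm]⟩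

/-- The element `𝔼_I x` of the summand `𝔼_I bH_n(q)`. -/
def proj (I : LinearSetPartition n) (x : BHecke n) : I.summand := ⟨I.idem * x, x, rfl⟩

end LinearSetPartition

/-! ### Young subgroups and Young Hecke algebras -/

/-- The Young subgroup `𝔖_μ`: the permutations that preserve each of the consecutive intervals of
sizes `μ_1, …, μ_k`. -/
def youngSubgroup {n : ℕ} (μ : Composition n) : Subgroup (Equiv.Perm (Fin n)) where
  carrier := {w | ∀ i, μ.index (w i) = μ.index i}
  one_mem' := fun _ => rfl
  mul_mem' := by
    intro a b ha hb i
    rw [Equiv.Perm.mul_apply, ha, hb]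
  inv_mem' := by
    intro a ha i
    have h := ha (a⁻¹ i)
    have e : a (a⁻¹ i) = i := a.apply_symm_apply i
    rw [e] at h
    exact h.symm

/-- The Young Hecke algebra `H_μ`: the subalgebra of `H_n(q)` generated by the `h_i` such that `s_i`
lies in the Young subgroup of `μ`. -/
def youngHecke {n : ℕ} (μ : Composition n) : Subalgebra GroundRing (Hecke n) :=
  Algebra.adjoin GroundRing {x | ∃ i : Fin (n - 1), simple i ∈ youngSubgroup μ ∧ x = Hecke.h i}

/-- The tensor product `H_{μ_1} ⊗ ⋯ ⊗ H_{μ_k}` over the ground ring. -/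
abbrev tensorHecke {n : ℕ} (μ : Composition n) : Type :=
  ⨂[GroundRing] j : Fin μ.length, Hecke (μ.blocksFun j)

/-- The product `w_1 ⋯ w_k` in `𝔖_n` of permutations `w_j` in `𝔖_{μ_j}`, where `w_j` acts on the
`j`-th of the consecutive intervals of sizes `μ_1, …, μ_k`. -/
def blockPerm {n : ℕ} (μ : Composition n)
    (w : ∀ j : Fin μ.length, Equiv.Perm (Fin (μ.blocksFun j))) : Equiv.Perm (Fin n) :=
  μ.blocksFinEquiv.permCongr (Equiv.Perm.sigmaCongrRight w)

end TiedBoxed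

end

/-!
Everything rests on the standard basis of the Iwahori-Hecke algebra. The algebra `H_n(q)` acts on
the free module on `𝔖_n`: `h_i` sends `v` to `v s_i` if `v` has an ascent at `i`, and otherwise to
`v s_i + (q - q⁻¹) v`. In a reduced expression each letter is added at an ascent
(`IsReducedExpr.of_cons`), so `x ↦ x · 1` sends `h_w` to `w⁻¹` (`orbitMap_word`) and is onto a
free module of rank `n!`. On the other hand `n!` elements span `H_n(q)`, by the normal form for
the cosets of `𝔖_{k}` in `𝔖_{k+1}` (`exists_finset_span`), and a surjective endomorphism of a
finitely generated module is injective. So `x ↦ x · 1` is an isomorphism (`orbitMap_injective`).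
This gives the basis of the `h_w`, and their independence of the reduced expression without
Matsumoto's theorem.

The tensor product of the bases of the `H_{μ_j}` maps to basis elements of `H_n(q)` indexed by
distinct elements of `𝔖_μ` (`orbitMap_tensorBasis`), so `H_{μ_1} ⊗ ⋯ ⊗ H_{μ_k} → H_n(q)` is
injective (`tensorToHecke_injective`), and its image is `H_μ`.

A linear set partition `I` is determined by its ties, the `i` such that `i` and `i + 1` lie in the
same block. All sets of ties occur (`ties_bijective`), and `𝔼_I` is the product of the central
elements `e_i` over the ties and `1 - e_i` over the other `i` (`idem_eq_signedProd`). Hence the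
`𝔼_I` are complete orthogonal idempotents, and in `𝔼_I bH_n(q)` each `e_i` becomes `1` or `0`, and
`z_i` is killed unless `i` is a tie. There is a homomorphism `bH_n(q) → H_n(q)` that does the same
and sends the remaining `z_i` to `h_i` (`toHecke`). It is injective on `𝔼_I bH_n(q)`, because
every element of the summand comes from the tensor product by a map whose composite with it is the
injection above (`toHecke_fromTensor`, `exists_idem_mul_fromTensor`). The components combine to
the decomposition of `bH_n(q)` since the idempotents are complete and orthogonal.
-/

open scoped TensorProduct BigOperators Nat

noncomputable section

namespace TiedBoxed

/-! ### Inversions and reduced expressions -/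

variable {n : ℕ}

theorem left_lt_right (i : Fin (n - 1)) : left i < right i := by
  simp [left, right, Fin.lt_def]

theorem simple_val (i : Fin (n - 1)) (a : Fin n) :
    (simple i a : ℕ) = if (a : ℕ) = i then (i : ℕ) + 1 else if (a : ℕ) = i + 1 then i else a := by
  simp only [simple, Equiv.swap_apply_def, left, right, Fin.ext_iff]
  split_ifs <;> rfl

@[simp]
theorem simple_mul_self (i : Fin (n - 1)) : simple i * simple i = 1 := Equiv.swap_mul_self _ _

@[simp]
theorem simple_inv (i : Fin (n - 1)) : (simple i)⁻¹ = simple i := Equiv.swap_inv _ _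

@[simp]
theorem simple_simple (i : Fin (n - 1)) (a : Fin n) : simple i (simple i a) = a := by
  rw [← Equiv.Perm.mul_apply, simple_mul_self, Equiv.Perm.one_apply]

@[simp]
theorem simple_left (i : Fin (n - 1)) : simple i (left i) = right i := Equiv.swap_apply_left _ _

@[simp]
theorem simple_right (i : Fin (n - 1)) : simple i (right i) = left i := Equiv.swap_apply_right _ _

/-- The set of inversions of a permutation, as pairs of positions. -/
def inversions (w : Equiv.Perm (Fin n)) : Finset (Fin n × Fin n) :=
  Finset.univ.filter fun p => p.1 < p.2 ∧ w p.2 < w p.1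

theorem mem_inversions {w : Equiv.Perm (Fin n)} {p : Fin n × Fin n} :
    p ∈ inversions w ↔ p.1 < p.2 ∧ w p.2 < w p.1 := by
  simp [inversions]

/-- `s_i` preserves the order of every pair of positions other than `(i, i + 1)`. -/
theorem simple_lt_simple {i : Fin (n - 1)} {a b : Fin n} (hab : a < b)
    (h : ¬(a = left i ∧ b = right i)) : simple i a < simple i b := by
  rw [Fin.lt_def, simple_val, simple_val]
  simp only [left, right, Fin.ext_iff, Fin.lt_def] at *
  split_ifs <;> omega

theorem inversions_mul_simple {w : Equiv.Perm (Fin n)} {i : Fin (n - 1)}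
    (h : w (left i) < w (right i)) :
    inversions (w * simple i) = insert (left i, right i)
      ((inversions w).map ((simple i).prodCongr (simple i)).toEmbedding) := by
  have hlr := left_lt_right i
  ext ⟨a, b⟩
  simp only [Finset.mem_insert, Finset.mem_map_equiv, Prod.mk.injEq, mem_inversions,
    Equiv.prodCongr_symm, Equiv.prodCongr_apply, Prod.map, Equiv.Perm.mul_apply]
  have hs : (simple i).symm = simple i := simple_inv i
  rw [hs]
  by_cases hab : a = left i ∧ b = right i
  · obtain ⟨rfl, rfl⟩ := hab
    simp [hlr, h]
  · simp only [hab, false_or]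
    refine and_congr_left fun hw => ⟨fun h' => simple_lt_simple h' hab, fun h' => ?_⟩
    by_cases h'' : simple i a = left i ∧ simple i b = right i
    · rw [h''.1, h''.2] at hw
      exact absurd hw h.not_gt
    · simpa using simple_lt_simple h' h''

/-- The number of inversions. -/
def numInversions (w : Equiv.Perm (Fin n)) : ℕ := (inversions w).card

/-- Multiplication by `s_i` at an ascent creates one inversion, the pair `(i, i + 1)`, and moves the
others. -/
theorem numInversions_mul_simple {w : Equiv.Perm (Fin n)} {i : Fin (n - 1)}
    (h : w (left i) < w (right i)) : numInversions (w * simple i) = numInversions w + 1 := by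
  rw [numInversions, inversions_mul_simple h, Finset.card_insert_of_notMem, Finset.card_map,
    numInversions]
  have hs : (simple i).symm = simple i := simple_inv i
  simp [Finset.mem_map_equiv, mem_inversions, hs, (left_lt_right i).not_gt]

theorem numInversions_mul_simple' {w : Equiv.Perm (Fin n)} {i : Fin (n - 1)}
    (h : w (right i) < w (left i)) : numInversions w = numInversions (w * simple i) + 1 := by
  rw [← numInversions_mul_simple (i := i) (by simpa using h), mul_assoc, simple_mul_self, mul_one]

theorem lt_or_gt_left_right (w : Equiv.Perm (Fin n)) (i : Fin (n - 1)) :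
    w (left i) < w (right i) ∨ w (right i) < w (left i) :=
  lt_or_gt_of_ne (w.injective.ne (left_lt_right i).ne)

theorem eq_one_of_forall_lt {w : Equiv.Perm (Fin n)}
    (h : ∀ i, w (left i) < w (right i)) : w = 1 := by
  cases n with
  | zero => exact Subsingleton.elim _ _
  | succ m =>
    have hm : StrictMono w := Fin.strictMono_iff_lt_succ.2 fun i => h i
    have := Subsingleton.elim (hm.orderIsoOfSurjective w w.surjective) (OrderIso.refl _)
    ext i
    exact congrArg Fin.val (DFunLike.congr_fun this i)

@[simp]
theorem numInversions_one : numInversions (1 : Equiv.Perm (Fin n)) = 0 := by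
  rw [numInversions, Finset.card_eq_zero, Finset.eq_empty_iff_forall_notMem]
  intro p hp
  rw [mem_inversions] at hp
  exact absurd hp.1 hp.2.not_gt

/-- The product `s_{i_1} ⋯ s_{i_r}` in the symmetric group. -/
def permWord (L : List (Fin (n - 1))) : Equiv.Perm (Fin n) := (L.map simple).prod

@[simp]
theorem permWord_nil : permWord ([] : List (Fin (n - 1))) = 1 := rfl

@[simp]
theorem permWord_cons (i : Fin (n - 1)) (L : List (Fin (n - 1))) :
    permWord (i :: L) = simple i * permWord L := by
  simp [permWord]

/-- Multiplying by simple transpositions at descents sorts a permutation in as many steps as it has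
inversions. -/
theorem exists_permWord_eq_inv (w : Equiv.Perm (Fin n)) :
    ∃ L, permWord L = w⁻¹ ∧ L.length = numInversions w := by
  induction hk : numInversions w using Nat.strong_induction_on generalizing w with
  | _ k ih =>
    by_cases h : ∀ i, w (left i) < w (right i)
    · refine ⟨[], ?_, ?_⟩
      · simp [eq_one_of_forall_lt h]
      · rw [← hk, eq_one_of_forall_lt h]; simp
    · obtain ⟨i, hi⟩ := not_forall.1 h
      have hi' := numInversions_mul_simple' ((lt_or_gt_left_right w i).resolve_left hi)
      obtain ⟨L, hL, hl⟩ := ih _ (by omega) (w * simple i) rfl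
      refine ⟨i :: L, ?_, by simp; omega⟩
      rw [permWord_cons, hL]
      simp [← mul_assoc]

theorem numInversions_permWord_le (L : List (Fin (n - 1))) :
    numInversions (permWord L)⁻¹ ≤ L.length := by
  induction L with
  | nil => simp
  | cons i L ih =>
    rw [permWord_cons, mul_inv_rev, simple_inv, List.length_cons]
    rcases lt_or_gt_left_right (permWord L)⁻¹ i with h | h
    · rw [numInversions_mul_simple h]; omega
    · have := numInversions_mul_simple' h; omega

/-- An expression is reduced if and only if its length is the number of inversions. -/
theorem isReducedExpr_iff {w : Equiv.Perm (Fin n)} {L : List (Fin (n - 1))} :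
    IsReducedExpr w L ↔ permWord L = w ∧ L.length = numInversions w⁻¹ := by
  refine and_congr_right fun hL => ⟨fun h => ?_, fun h L' hL' => ?_⟩
  · obtain ⟨L', hL', hl⟩ := exists_permWord_eq_inv w⁻¹
    rw [inv_inv] at hL'
    refine le_antisymm (hl ▸ h L' hL') ?_
    have hL : permWord L = w := hL
    exact hL ▸ numInversions_permWord_le L
  · have hL' : permWord L' = w := hL'
    rw [h, ← hL']
    exact numInversions_permWord_le L'

theorem exists_isReducedExpr (w : Equiv.Perm (Fin n)) : ∃ L, IsReducedExpr w L := by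
  obtain ⟨L, hL, hl⟩ := exists_permWord_eq_inv w⁻¹
  exact ⟨L, isReducedExpr_iff.2 ⟨by simpa using hL, hl⟩⟩

theorem IsReducedExpr.permWord_eq {w : Equiv.Perm (Fin n)} {L : List (Fin (n - 1))}
    (h : IsReducedExpr w L) : permWord L = w := h.1

/-- Removing the first letter of a reduced expression leaves a reduced expression, to which the
letter was added at an ascent. -/
theorem IsReducedExpr.of_cons {w : Equiv.Perm (Fin n)} {i : Fin (n - 1)} {L : List (Fin (n - 1))}
    (h : IsReducedExpr w (i :: L)) :
    IsReducedExpr (permWord L) L ∧ (permWord L)⁻¹ (left i) < (permWord L)⁻¹ (right i) := by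
  rw [isReducedExpr_iff] at h ⊢
  obtain ⟨rfl, h⟩ := h
  rw [permWord_cons, mul_inv_rev, simple_inv, List.length_cons] at h
  have hle := numInversions_permWord_le L
  rcases lt_or_gt_left_right (permWord L)⁻¹ i with h' | h'
  · rw [numInversions_mul_simple h'] at h
    exact ⟨⟨rfl, by omega⟩, h'⟩
  · have := numInversions_mul_simple' h'
    omega

/-! ### The regular representation of the Hecke algebra -/

section HeckeLift

variable {S : Type*} [Ring S] [Algebra GroundRing S]

/-- The quotient map from the free algebra to `H_n(q)`. -/
def Hecke.mk (n : ℕ) : FreeAlgebra GroundRing (Fin (n - 1)) →ₐ[GroundRing] Hecke n :=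
  RingQuot.mkAlgHom GroundRing (HeckeRel n)

theorem Hecke.mk_ι (i : Fin (n - 1)) :
    Hecke.mk n (FreeAlgebra.ι GroundRing i) = Hecke.h i := rfl

theorem Hecke.mk_rel {a b : FreeAlgebra GroundRing (Fin (n - 1))} (h : HeckeRel n a b) :
    Hecke.mk n a = Hecke.mk n b :=
  RingQuot.mkAlgHom_rel GroundRing h

theorem Hecke.mk_surjective : Function.Surjective (Hecke.mk n) :=
  RingQuot.mkAlgHom_surjective GroundRing (HeckeRel n)

/-- The algebra homomorphism on `H_n(q)` determined by elements satisfying the defining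
relations. -/
def Hecke.lift (x : Fin (n - 1) → S)
    (braid : ∀ i j : Fin (n - 1), (i : ℕ) + 1 = j → x i * x j * x i = x j * x i * x j)
    (comm : ∀ i j : Fin (n - 1), (i : ℕ) + 1 < j → x i * x j = x j * x i)
    (quad : ∀ i, x i * x i = 1 + qDiff • x i) : Hecke n →ₐ[GroundRing] S :=
  RingQuot.liftAlgHom GroundRing ⟨FreeAlgebra.lift GroundRing x, by
    intro a b hab
    induction hab with
    | braid i j h =>
      simp only [map_mul, FreeAlgebra.lift_ι_apply]
      exact h.elim (braid i j) fun h => (braid j i h).symm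
    | comm i j h =>
      simp only [map_mul, FreeAlgebra.lift_ι_apply]
      exact h.elim (comm i j) fun h => (comm j i h).symm
    | quad i =>
      simp only [map_mul, map_add, map_one, map_smul, FreeAlgebra.lift_ι_apply]
      exact quad i⟩

@[simp]
theorem Hecke.lift_h (x : Fin (n - 1) → S) (braid comm quad) (i : Fin (n - 1)) :
    Hecke.lift x braid comm quad (Hecke.h i) = x i := by
  unfold Hecke.lift Hecke.h
  erw [RingQuot.liftAlgHom_mkAlgHom_apply]
  exact FreeAlgebra.lift_ι_apply _ _

theorem Hecke.h_braid {i j : Fin (n - 1)} (h : (i : ℕ) + 1 = j) :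
    Hecke.h i * Hecke.h j * Hecke.h i = Hecke.h j * Hecke.h i * Hecke.h j := by
  have := Hecke.mk_rel (HeckeRel.braid i j (Or.inl h))
  simpa only [map_mul, Hecke.mk_ι] using this

theorem Hecke.h_comm {i j : Fin (n - 1)} (h : (i : ℕ) + 1 < j) :
    Hecke.h i * Hecke.h j = Hecke.h j * Hecke.h i := by
  have := Hecke.mk_rel (HeckeRel.comm i j (Or.inl h))
  simpa only [map_mul, Hecke.mk_ι] using this

theorem Hecke.h_quad (i : Fin (n - 1)) :
    Hecke.h i * Hecke.h i = 1 + qDiff • Hecke.h i := by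
  have := Hecke.mk_rel (HeckeRel.quad i)
  simpa only [map_mul, map_add, map_one, map_smul, Hecke.mk_ι] using this

theorem Hecke.adjoin_range_h :
    Algebra.adjoin GroundRing (Set.range (Hecke.h : Fin (n - 1) → Hecke n)) = ⊤ := by
  have h1 : Set.range (Hecke.h : Fin (n - 1) → Hecke n) =
      Hecke.mk n '' Set.range (FreeAlgebra.ι GroundRing) := by
    rw [← Set.range_comp]; rfl
  rw [h1, ← AlgHom.map_adjoin, FreeAlgebra.adjoin_range_ι, Algebra.map_top, AlgHom.range_eq_top]
  exact Hecke.mk_surjective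

theorem Hecke.algHom_ext {f g : Hecke n →ₐ[GroundRing] S}
    (h : ∀ i, f (Hecke.h i) = g (Hecke.h i)) : f = g := by
  refine AlgHom.ext_of_adjoin_eq_top Hecke.adjoin_range_h ?_
  rintro _ ⟨i, rfl⟩
  exact h i

end HeckeLift

section HeckeOp

variable {R : Type*} [CommRing R] (c : R)

/-- The basis vector at a permutation of the free module on the symmetric group. -/
def vec (R : Type*) [CommRing R] (v : Equiv.Perm (Fin n)) : Equiv.Perm (Fin n) →₀ R :=
  Finsupp.single v 1

open Classical in
/-- The operator by which `h_i` acts on the free module on the symmetric group: it sends `v` to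
`v s_i` at an ascent, and to `v s_i + c v` at a descent, where `c` stands for `q - q⁻¹`. -/
def heckeOp (i : Fin (n - 1)) : (Equiv.Perm (Fin n) →₀ R) →ₗ[R] (Equiv.Perm (Fin n) →₀ R) :=
  Finsupp.linearCombination R fun v =>
    vec R (v * simple i) + (if v (left i) < v (right i) then 0 else c) • vec R v

open Classical in
theorem heckeOp_vec (i : Fin (n - 1)) (v : Equiv.Perm (Fin n)) :
    heckeOp c i (vec R v) =
      vec R (v * simple i) + (if v (left i) < v (right i) then 0 else c) • vec R v := by
  rw [heckeOp, vec, Finsupp.linearCombination_single, one_smul]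
  rfl

theorem linearMap_ext_vec {M : Type*} [AddCommGroup M] [Module R M]
    {f g : (Equiv.Perm (Fin n) →₀ R) →ₗ[R] M} (h : ∀ v, f (vec R v) = g (vec R v)) : f = g :=
  Finsupp.lhom_ext' fun v => LinearMap.ext_ring (h v)

theorem heckeOp_quad (i : Fin (n - 1)) :
    heckeOp c i * heckeOp c i = 1 + c • heckeOp c i := by
  refine linearMap_ext_vec fun v => ?_
  rcases lt_or_gt_left_right v i with h | h <;>
  · simp [heckeOp_vec, mul_assoc, h, h.not_gt]
    try abel

theorem simple_comm {i j : Fin (n - 1)} (h : (i : ℕ) + 1 < j) :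
    simple i * simple j = simple j * simple i := by
  ext a
  simp only [Equiv.Perm.mul_apply, simple_val]
  split_ifs <;> omega

theorem simple_braid {i j : Fin (n - 1)} (h : (i : ℕ) + 1 = j) :
    simple i * simple j * simple i = simple j * simple i * simple j := by
  have hj : left j = right i := Fin.ext h.symm
  have h1 : left i ≠ right i := (left_lt_right i).ne
  have h2 : right i ≠ right j := (hj ▸ left_lt_right j).ne
  have h3 : left i ≠ right j := Fin.ne_of_val_ne (by simp only [left, right]; omega)
  simp only [simple, hj]
  have e1 := Equiv.swap_mul_swap_mul_swap h2.symm h3.symm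
  have e2 := Equiv.swap_mul_swap_mul_swap h1 h3
  rw [Equiv.swap_comm (right j) (right i), Equiv.swap_comm (right i) (left i)] at e1
  exact e1.trans ((Equiv.swap_comm _ _).trans e2.symm)

theorem simple_apply_of_ne {i : Fin (n - 1)} {a : Fin n} (h1 : (a : ℕ) ≠ i)
    (h2 : (a : ℕ) ≠ i + 1) : simple i a = a := by
  ext
  simp [simple_val, h1, h2]

theorem heckeOp_comm {i j : Fin (n - 1)} (h : (i : ℕ) + 1 < j) :
    heckeOp c i * heckeOp c j = heckeOp c j * heckeOp c i := by
  have h1 : simple i (left j) = left j := simple_apply_of_ne (by simp [left]; omega)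
    (by simp [left]; omega)
  have h2 : simple i (right j) = right j := simple_apply_of_ne (by simp [right]; omega)
    (by simp [right]; omega)
  have h3 : simple j (left i) = left i := simple_apply_of_ne (by simp [left]; omega)
    (by simp [left]; omega)
  have h4 : simple j (right i) = right i := simple_apply_of_ne (by simp [right]; omega)
    (by simp [right]; omega)
  refine linearMap_ext_vec fun v => ?_
  simp only [Module.End.mul_apply, heckeOp_vec, map_add, map_smul, Equiv.Perm.mul_apply, h1, h2,
    h3, h4, mul_assoc, simple_comm h]
  module

theorem heckeOp_braid {i j : Fin (n - 1)} (h : (i : ℕ) + 1 = j) :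
    heckeOp c i * heckeOp c j * heckeOp c i = heckeOp c j * heckeOp c i * heckeOp c j := by
  have h0 : left j = right i := Fin.ext h.symm
  have h1 : simple i (right j) = right j := simple_apply_of_ne (by simp [right]; omega)
    (by simp [right]; omega)
  have h2 : simple j (left i) = left i := simple_apply_of_ne (by simp [left]; omega)
    (by simp [left]; omega)
  have h3 : simple j (right i) = right j := by rw [← h0, simple_left]
  have h4 : simple j (right j) = right i := by rw [← h0, simple_right]
  have hb := simple_braid h
  rw [mul_assoc, mul_assoc] at hb
  have key : ∀ a b c : Fin n, a ≠ b → b ≠ c → a ≠ c →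
      (a < b ∧ b < c ∧ a < c ∧ ¬ b < a ∧ ¬ c < b ∧ ¬ c < a) ∨
      (a < b ∧ c < b ∧ a < c ∧ ¬ b < a ∧ ¬ b < c ∧ ¬ c < a) ∨
      (a < b ∧ c < b ∧ c < a ∧ ¬ b < a ∧ ¬ b < c ∧ ¬ a < c) ∨
      (b < a ∧ b < c ∧ a < c ∧ ¬ a < b ∧ ¬ c < b ∧ ¬ c < a) ∨
      (b < a ∧ b < c ∧ c < a ∧ ¬ a < b ∧ ¬ c < b ∧ ¬ a < c) ∨
      (b < a ∧ c < b ∧ c < a ∧ ¬ a < b ∧ ¬ b < c ∧ ¬ a < c) := by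
    intro a b c hab hbc hac
    rcases lt_or_gt_of_ne hab with h1 | h1 <;> rcases lt_or_gt_of_ne hbc with h2 | h2 <;>
      rcases lt_or_gt_of_ne hac with h3 | h3 <;>
      simp only [h1, h2, h3, h1.not_gt, h2.not_gt, h3.not_gt, and_true, true_and, not_false_eq_true,
        or_true, false_and, and_false, or_false] <;>
      first
      | exact absurd (h1.trans h2) h3.not_gt
      | exact absurd (h2.trans h1) h3.not_gt
  refine linearMap_ext_vec fun v => ?_
  simp only [Module.End.mul_apply, heckeOp_vec, map_add, map_smul, Equiv.Perm.mul_apply, h0, h1, h2,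
    h3, h4, simple_left, simple_right, mul_assoc, hb, simple_mul_self, mul_one]
  have hlj : right i < right j := h0 ▸ left_lt_right j
  rcases key (v (left i)) (v (right i)) (v (right j))
    (v.injective.ne (left_lt_right i).ne) (v.injective.ne hlj.ne)
    (v.injective.ne ((left_lt_right i).trans hlj).ne) with h | h | h | h | h | h <;>
  · obtain ⟨k1, k2, k3, k4, k5, k6⟩ := h
    simp only [k1, k2, k3, k4, k5, k6, if_true, if_false]
    module

end HeckeOp

/-- The free module on the symmetric group, on which `H_n(q)` acts. -/
abbrev PermModule (n : ℕ) : Type := Equiv.Perm (Fin n) →₀ GroundRing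

/-- The action of `H_n(q)` on `PermModule n`. -/
def heckeRep (n : ℕ) : Hecke n →ₐ[GroundRing] Module.End GroundRing (PermModule n) :=
  Hecke.lift (heckeOp qDiff) (fun _ _ => heckeOp_braid qDiff) (fun _ _ => heckeOp_comm qDiff)
    (heckeOp_quad qDiff)

@[simp]
theorem heckeRep_h (i : Fin (n - 1)) : heckeRep n (Hecke.h i) = heckeOp qDiff i :=
  Hecke.lift_h _ _ _ _ _

/-- The map `x ↦ x · 1`, the orbit map of the basis vector at the permutation `1`. -/
def orbitMap (n : ℕ) : Hecke n →ₗ[GroundRing] PermModule n :=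
  LinearMap.applyₗ (vec _ 1) ∘ₗ (heckeRep n).toLinearMap

theorem orbitMap_apply (x : Hecke n) : orbitMap n x = heckeRep n x (vec _ 1) := rfl

theorem Hecke.word_cons (i : Fin (n - 1)) (L : List (Fin (n - 1))) :
    Hecke.word (i :: L) = Hecke.h i * Hecke.word L := by
  simp [Hecke.word]

/-- In a reduced expression every letter is added at an ascent, so no correction terms appear when
`h_w` acts on the basis vector at `1`. -/
theorem orbitMap_word {w : Equiv.Perm (Fin n)} {L : List (Fin (n - 1))} (h : IsReducedExpr w L) :
    orbitMap n (Hecke.word L) = vec _ w⁻¹ := by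
  induction L generalizing w with
  | nil =>
    rw [← h.permWord_eq, orbitMap_apply]
    simp [Hecke.word]
  | cons i L ih =>
    obtain ⟨h1, h2⟩ := h.of_cons
    rw [orbitMap_apply, Hecke.word_cons, map_mul, Module.End.mul_apply, ← orbitMap_apply, ih h1,
      heckeRep_h, heckeOp_vec, if_pos h2, zero_smul, add_zero, ← h.permWord_eq, permWord_cons,
      mul_inv_rev, simple_inv]

/-! ### A small spanning set of the Hecke algebra -/

section Spanning

variable {R S : Type*} [CommRing R] [Ring S] [Algebra R S]

/-- The descending product `x_k x_{k-1} ⋯` with `t` factors. -/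
def descProd (x : ℕ → S) (k : ℕ) : ℕ → S
  | 0 => 1
  | t + 1 => descProd x k t * x (k - t)

variable {x : ℕ → S} {N : ℕ} {c : R}

theorem descProd_mul_comm (hc : ∀ i j, i + 1 < j → j < N → x i * x j = x j * x i) {k : ℕ}
    (hk : k < N) (t i : ℕ) (hi : i + t < k) :
    descProd x k t * x i = x i * descProd x k t := by
  induction t with
  | zero => simp [descProd]
  | succ t ih =>
    rw [descProd, mul_assoc, ← hc i (k - t) (by omega) (by omega), ← mul_assoc, ih (by omega),
      mul_assoc]

/-- Passing through both `x_{i+1}` and `x_i` in the descending product lowers the index, by the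
braid relation. -/
theorem descProd_mul_shift
    (hb : ∀ i, i + 1 < N → x i * x (i + 1) * x i = x (i + 1) * x i * x (i + 1))
    (hc : ∀ i j, i + 1 < j → j < N → x i * x j = x j * x i) {k : ℕ} (hk : k < N)
    (t i : ℕ) (ht : t ≤ k + 1) (hi : i + 1 ≤ k) (hit : k < i + t) :
    descProd x k t * x (i + 1) = x i * descProd x k t := by
  induction t with
  | zero => omega
  | succ t ih =>
    rcases eq_or_lt_of_le (show k ≤ i + t by omega) with h | h
    · obtain ⟨u, rfl⟩ : ∃ u, t = u + 1 := ⟨t - 1, by omega⟩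
      have e1 : k - u = i + 1 := by omega
      have e2 : k - (u + 1) = i := by omega
      rw [descProd, descProd, e1, e2, mul_assoc, mul_assoc, ← mul_assoc (x (i + 1)),
        ← hb i (by omega), ← mul_assoc, ← mul_assoc, descProd_mul_comm hc hk u i (by omega)]
      simp only [mul_assoc]
    · rw [descProd, mul_assoc, hc (k - t) (i + 1) (by omega) (by omega), ← mul_assoc,
        ih (by omega) (by omega), mul_assoc]

open scoped Pointwise in
/-- If `B` is generated by `x_0, …, x_{k-1}`, then the algebra generated by `x_0, …, x_k` is the sum of
the `k + 2` subspaces `B x_k x_{k-1} ⋯ x_{k-t+1}` with `0 ≤ t ≤ k + 1`. -/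
theorem exists_finset_span
    (hb : ∀ i, i + 1 < N → x i * x (i + 1) * x i = x (i + 1) * x i * x (i + 1))
    (hc : ∀ i j, i + 1 < j → j < N → x i * x j = x j * x i)
    (hq : ∀ i < N, x i * x i = 1 + c • x i) (k : ℕ) (hk : k ≤ N) :
    ∃ F : Finset S, F.card ≤ (k + 1)! ∧
      Subalgebra.toSubmodule (Algebra.adjoin R (x '' Set.Iio k)) ≤
        Submodule.span R (F : Set S) := by
  classical
  induction k with
  | zero =>
    refine ⟨{1}, by simp, ?_⟩
    rw [Set.Iio_zero_eq_empty, Set.image_empty, Algebra.adjoin_empty, Algebra.toSubmodule_bot,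
      Submodule.one_eq_span, Finset.coe_singleton]
  | succ k ih =>
    obtain ⟨F, hF, hspan⟩ := ih (by omega)
    set D : Finset S := (Finset.range (k + 2)).image (descProd x k) with hD
    set B := Algebra.adjoin R (x '' Set.Iio k) with hB
    set M : Submodule R S := Subalgebra.toSubmodule B * Submodule.span R (D : Set S) with hM
    have hxB : ∀ i < k, x i ∈ B := fun i hi => Algebra.subset_adjoin ⟨i, hi, rfl⟩
    have hDmem : ∀ t ≤ k + 1, descProd x k t ∈ Submodule.span R (D : Set S) := fun t ht =>
      Submodule.subset_span (Finset.mem_image_of_mem _ (Finset.mem_range.2 (by omega)))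
    have hmem : ∀ b ∈ B, ∀ t ≤ k + 1, b * descProd x k t ∈ M := fun b hb t ht =>
      Submodule.mul_mem_mul hb (hDmem t ht)
    have hmem' : ∀ t ≤ k + 1, descProd x k t ∈ M := fun t ht => by
      simpa using hmem 1 B.one_mem t ht
    -- The four positions of `i` relative to the last factor `x_{k-t+1}` of the descending product.
    have hDx : ∀ t ≤ k + 1, ∀ i ≤ k, descProd x k t * x i ∈ M := by
      intro t ht i hi
      rcases lt_trichotomy (i + t) k with h | h | h
      · rw [descProd_mul_comm hc (by omega) t i h]
        exact hmem _ (hxB i (by omega)) t ht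
      · have : descProd x k (t + 1) = descProd x k t * x i := by
          rw [descProd, show k - t = i by omega]
        exact this ▸ hmem' (t + 1) (by omega)
      · rcases eq_or_lt_of_le (show k + 1 ≤ i + t by omega) with h | h
        · obtain ⟨u, rfl⟩ : ∃ u, t = u + 1 := ⟨t - 1, by omega⟩
          have hku : k - u = i := by omega
          have : descProd x k (u + 1) * x i = descProd x k u + c • descProd x k (u + 1) := by
            rw [descProd, hku, mul_assoc, hq i (by omega), mul_add, mul_one, mul_smul_comm]
          rw [this]
          exact M.add_mem (hmem' u (by omega)) (M.smul_mem _ (hmem' _ ht))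
        · obtain ⟨j, rfl⟩ : ∃ j, i = j + 1 := ⟨i - 1, by omega⟩
          rw [descProd_mul_shift hb hc (by omega) t j ht hi (by omega)]
          exact hmem _ (hxB j (by omega)) t ht
    have hBM : ∀ b ∈ B, ∀ m ∈ M, b * m ∈ M := by
      intro b hb m hm
      refine Submodule.mul_induction_on hm (fun b' hb' d hd => ?_) fun m m' h h' => ?_
      · rw [← mul_assoc]
        exact Submodule.mul_mem_mul (B.mul_mem hb hb') hd
      · rw [mul_add]
        exact M.add_mem h h'
    have hMx : ∀ i ≤ k, ∀ m ∈ M, m * x i ∈ M := by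
      intro i hi m hm
      refine Submodule.mul_induction_on hm (fun b hb d hd => ?_) fun m m' h h' => ?_
      · rw [mul_assoc]
        refine hBM b hb _ ?_
        refine Submodule.span_induction ?_ ?_ ?_ ?_ hd
        · intro d hd
          obtain ⟨t, ht, rfl⟩ := Finset.mem_image.1 (Finset.mem_coe.1 hd)
          exact hDx t (by simpa [Nat.lt_succ_iff] using ht) i hi
        · simp
        · intro d d' _ _ h h'
          rw [add_mul]
          exact M.add_mem h h'
        · intro r d _ h
          rw [smul_mul_assoc]
          exact M.smul_mem r h
      · rw [add_mul]
        exact M.add_mem h h'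
    have hadj : ∀ y ∈ Algebra.adjoin R (x '' Set.Iio (k + 1)), ∀ m ∈ M, m * y ∈ M := by
      intro y hy
      refine Algebra.adjoin_induction ?_ ?_ ?_ ?_ hy
      · rintro _ ⟨i, hi, rfl⟩ m hm
        exact hMx i (Nat.lt_succ_iff.1 hi) m hm
      · intro r m hm
        rw [← Algebra.commutes, ← Algebra.smul_def]
        exact M.smul_mem r hm
      · intro y z _ _ h h' m hm
        rw [mul_add]
        exact M.add_mem (h m hm) (h' m hm)
      · intro y z _ _ h h' m hm
        rw [← mul_assoc]
        exact h' _ (h m hm)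
    refine ⟨F * D, ?_, ?_⟩
    · calc (F * D).card ≤ F.card * D.card := Finset.card_mul_le
        _ ≤ (k + 1)! * (k + 2) := Nat.mul_le_mul hF (Finset.card_image_le.trans (by simp))
        _ = (k + 2)! := by rw [Nat.factorial_succ (k + 1), mul_comm]
    · intro y hy
      have h1 : y ∈ M := by simpa using hadj y hy 1 (hmem' 0 (by omega))
      rw [Finset.coe_mul, ← Submodule.span_mul_span]
      exact mul_le_mul_left hspan _ h1

end Spanning

theorem Hecke.exists_finset_span :
    ∃ F : Finset (Hecke n), F.card ≤ n ! ∧ Submodule.span GroundRing (F : Set (Hecke n)) = ⊤ := by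
  set x : ℕ → Hecke n := fun i => if h : i < n - 1 then Hecke.h ⟨i, h⟩ else 1 with hx
  have hxi : ∀ i (h : i < n - 1), x i = Hecke.h ⟨i, h⟩ := fun i h => dif_pos h
  obtain ⟨F, hF, hspan⟩ := TiedBoxed.exists_finset_span (R := GroundRing) (x := x) (N := n - 1)
    (c := qDiff)
    (fun i hi => by
      rw [hxi i (by omega), hxi (i + 1) hi]
      exact Hecke.h_braid rfl)
    (fun i j hij hj => by
      rw [hxi i (by omega), hxi j hj]
      exact Hecke.h_comm hij)
    (fun i hi => by
      rw [hxi i hi]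
      exact Hecke.h_quad _) (n - 1) le_rfl
  refine ⟨F, hF.trans ?_, ?_⟩
  · rcases n with _ | n <;> simp
  · refine top_le_iff.1 (le_trans ?_ hspan)
    rw [← Algebra.top_toSubmodule, ← Hecke.adjoin_range_h]
    refine Algebra.adjoin_mono ?_
    rintro _ ⟨i, rfl⟩
    exact ⟨i, i.2, hxi i i.2⟩

theorem orbitMap_surjective : Function.Surjective (orbitMap n) := by
  rw [← LinearMap.range_eq_top, ← top_le_iff]
  intro f _
  induction f using Finsupp.induction_linear with
  | zero => exact Submodule.zero_mem _
  | add f g hf hg => exact Submodule.add_mem _ (hf trivial) (hg trivial)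
  | single w r =>
    obtain ⟨L, hL⟩ := exists_isReducedExpr w⁻¹
    refine ⟨r • Hecke.word L, ?_⟩
    rw [map_smul, orbitMap_word hL, inv_inv, vec, Finsupp.smul_single, smul_eq_mul, mul_one]

/-- The orbit map is onto a free module of rank `n!`, and `n!` elements span its source. -/
theorem orbitMap_injective : Function.Injective (orbitMap n) := by
  classical
  obtain ⟨F, hF, hspan⟩ := Hecke.exists_finset_span (n := n)
  have hcard : Fintype.card F ≤ Fintype.card (Equiv.Perm (Fin n)) := by
    rwa [Fintype.card_coe, Fintype.card_perm, Fintype.card_fin]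
  obtain ⟨ι⟩ := Function.Embedding.nonempty_of_card_le hcard
  -- The surjection from the free module on the spanning set.
  let g : (F →₀ GroundRing) →ₗ[GroundRing] Hecke n :=
    Finsupp.linearCombination GroundRing (Subtype.val : F → Hecke n)
  have hg : Function.Surjective g := by
    rw [← LinearMap.range_eq_top, Finsupp.range_linearCombination, Subtype.range_val]
    exact hspan
  -- Followed by the orbit map, it maps a free module of rank at most `n!` onto one of rank `n!`.
  have hinj := OrzechProperty.injective_of_surjective_of_injective
    (Finsupp.lmapDomain GroundRing GroundRing ι) (orbitMap n ∘ₗ g)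
    (Finsupp.mapDomain_injective ι.injective) (orbitMap_surjective.comp hg)
  intro x y hxy
  obtain ⟨a, rfl⟩ := hg x
  obtain ⟨b, rfl⟩ := hg y
  rw [hinj (show (orbitMap n ∘ₗ g) a = (orbitMap n ∘ₗ g) b from hxy)]

/-- The basis of `H_n(q)` corresponding to the standard basis under the orbit map. The element
indexed by `w` is `h_{w⁻¹}`, because the left action of `h_i` multiplies permutations by `s_i` on the
right. -/
def heckeBasis (n : ℕ) : Module.Basis (Equiv.Perm (Fin n)) GroundRing (Hecke n) :=
  ⟨LinearEquiv.ofBijective (orbitMap n) ⟨orbitMap_injective, orbitMap_surjective⟩⟩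

theorem orbitMap_heckeBasis (w : Equiv.Perm (Fin n)) :
    orbitMap n (heckeBasis n w) = vec GroundRing w :=
  (LinearEquiv.ofBijective (orbitMap n)
    ⟨orbitMap_injective, orbitMap_surjective⟩).apply_symm_apply _

/-! ### Tensor products of Hecke algebras -/

section Blocks

variable (μ : Composition n)

theorem sizeUpTo_add_blocksFun_le (j : Fin μ.length) : μ.sizeUpTo j + μ.blocksFun j ≤ n :=
  (μ.sizeUpTo_succ' j).symm.trans_le (μ.sizeUpTo_le _)

/-- The position in `[n - 1]` of the `i`-th simple transposition of the `j`-th interval. -/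
def blockShift (j : Fin μ.length) (i : Fin (μ.blocksFun j - 1)) : Fin (n - 1) :=
  ⟨μ.sizeUpTo j + i, by have := sizeUpTo_add_blocksFun_le μ j; omega⟩

theorem left_blockShift (j : Fin μ.length) (i : Fin (μ.blocksFun j - 1)) :
    left (blockShift μ j i) = μ.embedding j (left i) := by
  ext
  simp [left, blockShift]

theorem right_blockShift (j : Fin μ.length) (i : Fin (μ.blocksFun j - 1)) :
    right (blockShift μ j i) = μ.embedding j (right i) := by
  ext
  simp [right, blockShift, add_assoc]

theorem blockPerm_embedding (w : ∀ j : Fin μ.length, Equiv.Perm (Fin (μ.blocksFun j)))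
    (j : Fin μ.length) (a : Fin (μ.blocksFun j)) :
    blockPerm μ w (μ.embedding j a) = μ.embedding j (w j a) := by
  have h : μ.embedding j a = μ.blocksFinEquiv ⟨j, a⟩ := rfl
  rw [blockPerm, Equiv.permCongr_apply, h, Equiv.symm_apply_apply]
  rfl

variable {μ} in
theorem exists_embedding_eq (a : Fin n) : ∃ j b, μ.embedding j b = a :=
  ⟨_, _, μ.embedding_comp_inv a⟩

theorem perm_ext_embedding {v w : Equiv.Perm (Fin n)}
    (h : ∀ j a, v (μ.embedding j a) = w (μ.embedding j a)) : v = w := by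
  refine Equiv.ext fun a => ?_
  obtain ⟨j, b, rfl⟩ := exists_embedding_eq (μ := μ) a
  exact h j b

theorem blockPerm_mul (v w : ∀ j : Fin μ.length, Equiv.Perm (Fin (μ.blocksFun j))) :
    blockPerm μ v * blockPerm μ w = blockPerm μ (v * w) := by
  refine perm_ext_embedding μ fun j a => ?_
  simp [blockPerm_embedding]

@[simp]
theorem blockPerm_one : blockPerm μ 1 = 1 := by
  refine perm_ext_embedding μ fun j a => ?_
  simp [blockPerm_embedding]

theorem blockPerm_inv (w : ∀ j : Fin μ.length, Equiv.Perm (Fin (μ.blocksFun j))) :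
    (blockPerm μ w)⁻¹ = blockPerm μ w⁻¹ := by
  rw [inv_eq_iff_mul_eq_one, blockPerm_mul, mul_inv_cancel, blockPerm_one]

theorem blockPerm_injective : Function.Injective (blockPerm μ) := by
  intro v w h
  funext j
  ext a
  have := congrArg (fun p : Equiv.Perm (Fin n) => p (μ.embedding j a)) h
  simp only [blockPerm_embedding] at this
  exact congrArg Fin.val ((μ.embedding j).injective this)

theorem blockPerm_mem (w : ∀ j : Fin μ.length, Equiv.Perm (Fin (μ.blocksFun j))) :
    blockPerm μ w ∈ youngSubgroup μ := by
  intro a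
  obtain ⟨j, b, rfl⟩ := exists_embedding_eq (μ := μ) a
  rw [blockPerm_embedding, μ.index_embedding, μ.index_embedding]

theorem simple_blockShift (j : Fin μ.length) (i : Fin (μ.blocksFun j - 1)) :
    simple (blockShift μ j i) = blockPerm μ (Function.update 1 j (simple i)) := by
  refine perm_ext_embedding μ fun k a => ?_
  rw [blockPerm_embedding, simple, left_blockShift, right_blockShift]
  by_cases h : k = j
  · subst h
    rw [Function.update_self]
    exact ((μ.embedding k).injective.map_swap _ _ _).symm
  · have h' : ∀ b, μ.embedding k a ≠ μ.embedding j b := fun b hb => h <| by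
      have := congrArg μ.index hb
      rwa [μ.index_embedding, μ.index_embedding] at this
    rw [Function.update_of_ne h, Equiv.swap_apply_of_ne_of_ne (h' _) (h' _)]
    rfl

theorem simple_blockShift_mem (j : Fin μ.length) (i : Fin (μ.blocksFun j - 1)) :
    simple (blockShift μ j i) ∈ youngSubgroup μ := by
  rw [simple_blockShift]
  exact blockPerm_mem μ _

theorem simple_mem_youngSubgroup_iff {i : Fin (n - 1)} :
    simple i ∈ youngSubgroup μ ↔ μ.index (left i) = μ.index (right i) := by
  constructor
  · intro h
    have := h (right i)
    rwa [simple_right] at this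
  · intro h a
    by_cases h1 : a = left i
    · rw [h1, simple_left, h]
    · by_cases h2 : a = right i
      · rw [h2, simple_right, h]
      · rw [simple, Equiv.swap_apply_of_ne_of_ne h1 h2]

theorem exists_blockShift_eq {i : Fin (n - 1)} (h : simple i ∈ youngSubgroup μ) :
    ∃ j k, blockShift μ j k = i := by
  rw [simple_mem_youngSubgroup_iff] at h
  have h1 := μ.sizeUpTo_index_le (left i)
  have h2 := μ.lt_sizeUpTo_index_succ (right i)
  rw [← h, Fin.val_succ, μ.sizeUpTo_succ'] at h2
  simp only [left, right] at h1 h2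
  refine ⟨μ.index (left i), ⟨i - μ.sizeUpTo (μ.index (left i)), ?_⟩, ?_⟩
  · simp only [left]; omega
  · ext
    simp only [blockShift, left]
    omega

theorem sizeUpTo_add_le_of_lt {j k : Fin μ.length} (h : j < k) :
    μ.sizeUpTo j + μ.blocksFun j ≤ μ.sizeUpTo k := by
  rw [← μ.sizeUpTo_succ' j]
  exact μ.monotone_sizeUpTo h

end Blocks

/-- The elements `x_i` with `i ∈ A` satisfy the relations of the Hecke algebra. -/
structure HeckeFamily {S : Type*} [Ring S] [Algebra GroundRing S]
    (A : Set (Fin (n - 1))) (x : Fin (n - 1) → S) : Prop where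
  braid : ∀ i ∈ A, ∀ j ∈ A, (i : ℕ) + 1 = j → x i * x j * x i = x j * x i * x j
  comm : ∀ i ∈ A, ∀ j ∈ A, (i : ℕ) + 1 < j → x i * x j = x j * x i
  quad : ∀ i ∈ A, x i * x i = 1 + qDiff • x i

theorem list_prod_map_mul_of_commute {ι S : Type*} [Monoid S] (f g : ι → S)
    (h : ∀ i j, i ≠ j → Commute (f i) (g j)) (l : List ι) (hl : l.Nodup) :
    (l.map fun i => f i * g i).prod = (l.map f).prod * (l.map g).prod := by
  induction l with
  | nil => simp
  | cons a l ih =>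
    rw [List.nodup_cons] at hl
    have : Commute (g a) (l.map f).prod := Commute.list_prod_right _ _ fun x hx => by
      obtain ⟨i, hi, rfl⟩ := List.mem_map.1 hx
      exact (h i a fun hia => hl.1 (hia ▸ hi)).symm
    simp only [List.map_cons, List.prod_cons, ih hl.2]
    rw [mul_assoc, ← mul_assoc (g a), this.eq]
    simp only [mul_assoc]

theorem Hecke.commute_map {m k : ℕ} {S : Type*} [Ring S] [Algebra GroundRing S]
    (f : Hecke m →ₐ[GroundRing] S) (g : Hecke k →ₐ[GroundRing] S)
    (h : ∀ i j, Commute (f (Hecke.h i)) (g (Hecke.h j))) (a : Hecke m) (b : Hecke k) :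
    Commute (f a) (g b) := by
  have hmem : ∀ {m : ℕ} (f : Hecke m →ₐ[GroundRing] S) (a : Hecke m),
      f a ∈ Algebra.adjoin GroundRing (Set.range fun i => f (Hecke.h i)) := by
    intro m f a
    have : (Set.range fun i => f (Hecke.h i)) = f '' Set.range Hecke.h := by
      rw [← Set.range_comp]; rfl
    rw [this, ← AlgHom.map_adjoin, Hecke.adjoin_range_h]
    exact ⟨a, trivial, rfl⟩
  refine Algebra.commute_of_mem_adjoin_of_forall_mem_commute (hmem g b) ?_
  rintro _ ⟨j, rfl⟩
  refine (Algebra.commute_of_mem_adjoin_of_forall_mem_commute (hmem f a) ?_).symm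
  rintro _ ⟨i, rfl⟩
  exact (h i j).symm

section TensorHom

variable {μ : Composition n} {S : Type*} [Ring S] [Algebra GroundRing S]
  {x : Fin (n - 1) → S} (hx : HeckeFamily {i | simple i ∈ youngSubgroup μ} x)

/-- The homomorphism from the `j`-th tensor factor. -/
def blockHom (j : Fin μ.length) : Hecke (μ.blocksFun j) →ₐ[GroundRing] S :=
  Hecke.lift (fun i => x (blockShift μ j i))
    (fun i k h => hx.braid _ (simple_blockShift_mem μ j i) _ (simple_blockShift_mem μ j k)
      (by simp only [blockShift]; omega))
    (fun i k h => hx.comm _ (simple_blockShift_mem μ j i) _ (simple_blockShift_mem μ j k)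
      (by simp only [blockShift]; omega))
    (fun i => hx.quad _ (simple_blockShift_mem μ j i))

@[simp]
theorem blockHom_h (j : Fin μ.length) (i : Fin (μ.blocksFun j - 1)) :
    blockHom hx j (Hecke.h i) = x (blockShift μ j i) :=
  Hecke.lift_h _ _ _ _ _

theorem blockHom_commute {j k : Fin μ.length} (hjk : j ≠ k) (a : Hecke (μ.blocksFun j))
    (b : Hecke (μ.blocksFun k)) : Commute (blockHom hx j a) (blockHom hx k b) := by
  refine Hecke.commute_map _ _ (fun i i' => ?_) a b
  rw [blockHom_h, blockHom_h]
  have hi := i.2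
  have hi' := i'.2
  rcases lt_or_gt_of_ne hjk with h | h
  · refine hx.comm _ (simple_blockShift_mem μ j i) _ (simple_blockShift_mem μ k i') ?_
    have := sizeUpTo_add_le_of_lt μ h
    simp only [blockShift]
    omega
  · refine (hx.comm _ (simple_blockShift_mem μ k i') _ (simple_blockShift_mem μ j i) ?_).symm
    have := sizeUpTo_add_le_of_lt μ h
    simp only [blockShift]
    omega

/-- The homomorphism on `H_{μ_1} ⊗ ⋯ ⊗ H_{μ_k}` determined by elements `x_i`, for `s_i` in the Young
subgroup, which satisfy the relations of the Hecke algebra. -/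
def tensorHom : tensorHecke μ →ₐ[GroundRing] S :=
  PiTensorProduct.liftAlgHom
    ((MultilinearMap.mkPiAlgebraFin GroundRing μ.length S).compLinearMap
      fun j => (blockHom hx j).toLinearMap)
    (by simp [List.prod_eq_one])
    (fun a b => by
      simp only [MultilinearMap.compLinearMap_apply, MultilinearMap.mkPiAlgebraFin_apply,
        AlgHom.toLinearMap_apply, Pi.mul_apply, map_mul, List.ofFn_eq_map]
      exact list_prod_map_mul_of_commute _ _ (fun i j h => blockHom_commute hx h _ _) _
        (List.nodup_finRange _))

theorem tensorHom_tprod (a : ∀ j : Fin μ.length, Hecke (μ.blocksFun j)) :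
    tensorHom hx (PiTensorProduct.tprod GroundRing a) =
      ((List.finRange μ.length).map fun j => blockHom hx j (a j)).prod := by
  rw [← List.ofFn_eq_map]
  simp [tensorHom]

theorem blockHom_mem (j : Fin μ.length) (a : Hecke (μ.blocksFun j)) :
    blockHom hx j a ∈
      Algebra.adjoin GroundRing {y | ∃ i, simple i ∈ youngSubgroup μ ∧ y = x i} := by
  have h : (⊤ : Subalgebra GroundRing (Hecke (μ.blocksFun j))) ≤ (Algebra.adjoin GroundRing
      {y | ∃ i, simple i ∈ youngSubgroup μ ∧ y = x i}).comap (blockHom hx j) := by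
    rw [← Hecke.adjoin_range_h, Algebra.adjoin_le_iff]
    rintro _ ⟨i, rfl⟩
    exact Algebra.subset_adjoin ⟨_, simple_blockShift_mem μ j i, blockHom_h hx j i⟩
  exact h trivial

theorem tensorHom_range :
    (tensorHom hx).range =
      Algebra.adjoin GroundRing {y | ∃ i, simple i ∈ youngSubgroup μ ∧ y = x i} := by
  refine le_antisymm ?_ (Algebra.adjoin_le ?_)
  · rintro _ ⟨t, rfl⟩
    induction t using PiTensorProduct.induction_on with
    | smul_tprod r a =>
      rw [AlgHom.toRingHom_eq_coe, RingHom.coe_coe, map_smul, tensorHom_tprod]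
      refine Subalgebra.smul_mem _ (Subalgebra.list_prod_mem _ ?_) r
      intro y hy
      obtain ⟨j, -, rfl⟩ := List.mem_map.1 hy
      exact blockHom_mem hx j _
    | add s t hs ht =>
      rw [map_add]
      exact add_mem hs ht
  · rintro _ ⟨i, hi, rfl⟩
    obtain ⟨j, k, rfl⟩ := exists_blockShift_eq μ hi
    refine ⟨PiTensorProduct.tprod GroundRing (Pi.mulSingle j (Hecke.h k)), ?_⟩
    rw [AlgHom.toRingHom_eq_coe, RingHom.coe_coe, tensorHom_tprod,
      List.prod_map_eq_pow_single j _ fun j' hj' _ => by rw [Pi.mulSingle_eq_of_ne hj', map_one],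
      List.count_eq_one_of_mem (List.nodup_finRange _) (List.mem_finRange j), pow_one,
      Pi.mulSingle_eq_same, blockHom_h]

theorem map_tensorHom {S' : Type*} [Ring S'] [Algebra GroundRing S'] {x' : Fin (n - 1) → S'}
    (hx' : HeckeFamily {i | simple i ∈ youngSubgroup μ} x') (f : S →ₐ[GroundRing] S')
    (h : ∀ i, simple i ∈ youngSubgroup μ → f (x i) = x' i) :
    f.comp (tensorHom hx) = tensorHom hx' := by
  have hblock : ∀ j, f.comp (blockHom hx j) = blockHom hx' j := fun j =>
    Hecke.algHom_ext fun i => by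
      rw [AlgHom.comp_apply, blockHom_h, blockHom_h, h _ (simple_blockShift_mem μ j i)]
  refine AlgHom.toLinearMap_injective (PiTensorProduct.ext (MultilinearMap.ext fun a => ?_))
  simp only [LinearMap.compMultilinearMap_apply, AlgHom.toLinearMap_apply, AlgHom.comp_apply,
    tensorHom_tprod, map_list_prod, List.map_map]
  congr 1
  refine List.map_congr_left fun j _ => ?_
  exact DFunLike.congr_fun (hblock j) (a j)

end TensorHom

theorem heckeFamily_h (A : Set (Fin (n - 1))) : HeckeFamily A (Hecke.h : _ → Hecke n) where
  braid _ _ _ _ := Hecke.h_braid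
  comm _ _ _ _ := Hecke.h_comm
  quad i _ := Hecke.h_quad i

/-- The homomorphism `H_{μ_1} ⊗ ⋯ ⊗ H_{μ_k} → H_n` that sends the generators to the generators. -/
def tensorToHecke (μ : Composition n) : tensorHecke μ →ₐ[GroundRing] Hecke n :=
  tensorHom (heckeFamily_h _)

theorem tensorToHecke_range (μ : Composition n) : (tensorToHecke μ).range = youngHecke μ :=
  tensorHom_range _

/-- Inclusion of permutations of the `j`-th interval, the permutations of the other intervals being
fixed, as a map of free modules. -/
def blockInclusion (μ : Composition n) (w : ∀ j : Fin μ.length, Equiv.Perm (Fin (μ.blocksFun j)))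
    (j : Fin μ.length) : PermModule (μ.blocksFun j) →ₗ[GroundRing] PermModule n :=
  Finsupp.lmapDomain GroundRing GroundRing fun u => blockPerm μ (Function.update w j u)

theorem blockInclusion_vec (μ : Composition n)
    (w : ∀ j : Fin μ.length, Equiv.Perm (Fin (μ.blocksFun j))) (j : Fin μ.length)
    (u : Equiv.Perm (Fin (μ.blocksFun j))) :
    blockInclusion μ w j (vec GroundRing u) =
      vec GroundRing (blockPerm μ (Function.update w j u)) := by
  rw [blockInclusion, vec, Finsupp.lmapDomain_apply, Finsupp.mapDomain_single, vec]

theorem heckeOp_blockInclusion (μ : Composition n)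
    (w : ∀ j : Fin μ.length, Equiv.Perm (Fin (μ.blocksFun j))) (j : Fin μ.length)
    (i : Fin (μ.blocksFun j - 1)) :
    heckeOp qDiff (blockShift μ j i) ∘ₗ blockInclusion μ w j =
      blockInclusion μ w j ∘ₗ heckeOp qDiff i := by
  refine linearMap_ext_vec fun u => ?_
  have h : Function.update w j u * Function.update
      (1 : ∀ j : Fin μ.length, Equiv.Perm (Fin (μ.blocksFun j))) j (simple i) =
      Function.update w j (u * simple i) := by
    funext k
    by_cases hk : k = j
    · subst hk; simp
    · simp [hk]
  simp only [LinearMap.comp_apply, blockInclusion_vec, heckeOp_vec, map_add, map_smul,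
    simple_blockShift, blockPerm_mul, h, left_blockShift, right_blockShift, blockPerm_embedding,
    Function.update_self, OrderEmbedding.lt_iff_lt]

theorem heckeRep_blockHom (μ : Composition n)
    (w : ∀ j : Fin μ.length, Equiv.Perm (Fin (μ.blocksFun j))) (j : Fin μ.length)
    (x : Hecke (μ.blocksFun j)) (m : PermModule (μ.blocksFun j)) :
    heckeRep n (blockHom (heckeFamily_h _) j x) (blockInclusion μ w j m) =
      blockInclusion μ w j (heckeRep _ x m) := by
  have hx : x ∈ Algebra.adjoin GroundRing (Set.range Hecke.h) := by
    rw [Hecke.adjoin_range_h]; trivial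
  induction hx using Algebra.adjoin_induction generalizing m with
  | mem x hx =>
    obtain ⟨i, rfl⟩ := hx
    rw [blockHom_h, heckeRep_h, heckeRep_h]
    exact LinearMap.congr_fun (heckeOp_blockInclusion μ w j i) m
  | algebraMap r => simp [Module.algebraMap_end_apply]
  | add x y _ _ h h' => simp only [map_add, LinearMap.add_apply, h, h']
  | mul x y _ _ h h' => simp only [map_mul, Module.End.mul_apply, h, h']

/-- The orbit maps are compatible with the decomposition of `w` in the Young subgroup as a product
of permutations of the intervals. -/
theorem orbitMap_tensorToHecke (μ : Composition n) (x : ∀ j : Fin μ.length, Hecke (μ.blocksFun j))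
    (v : ∀ j : Fin μ.length, Equiv.Perm (Fin (μ.blocksFun j)))
    (h : ∀ j, orbitMap _ (x j) = vec GroundRing (v j)) :
    orbitMap n (tensorToHecke μ (PiTensorProduct.tprod GroundRing x)) =
      vec GroundRing (blockPerm μ v) := by
  classical
  have key : ∀ l : List (Fin μ.length), l.Nodup →
      heckeRep n ((l.map fun j => blockHom (heckeFamily_h _) j (x j)).prod) (vec GroundRing 1) =
        vec GroundRing (blockPerm μ fun j => if j ∈ l then v j else 1) := by
    intro l hl
    induction l with
    | nil =>
      have h1 : (fun j : Fin μ.length =>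
          if j ∈ ([] : List (Fin μ.length)) then v j else 1) = 1 := by
        funext j; simp
      rw [h1, blockPerm_one]
      simp
    | cons a l ih =>
      rw [List.nodup_cons] at hl
      have h1 : (fun j => if j ∈ l then v j else 1) =
          Function.update (fun j => if j ∈ l then v j else 1) a 1 := by
        rw [Function.eq_update_iff]
        simp [hl.1]
      have h2 : (fun j => if j ∈ a :: l then v j else 1) =
          Function.update (fun j => if j ∈ l then v j else 1) a (v a) := by
        rw [Function.eq_update_iff]
        refine ⟨by simp, fun j hj => by simp [hj]⟩
      rw [List.map_cons, List.prod_cons, map_mul, Module.End.mul_apply, ih hl.2, h1,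
        ← blockInclusion_vec, heckeRep_blockHom, ← orbitMap_apply, h, blockInclusion_vec, h2]
  rw [orbitMap_apply, tensorToHecke, tensorHom_tprod, key _ (List.nodup_finRange _)]
  simp

/-- The basis of `H_{μ_1} ⊗ ⋯ ⊗ H_{μ_k}` of tensor products of basis elements. -/
def tensorBasis (μ : Composition n) :
    Module.Basis (∀ j : Fin μ.length, Equiv.Perm (Fin (μ.blocksFun j))) GroundRing
      (tensorHecke μ) :=
  Basis.piTensorProduct fun j => heckeBasis (μ.blocksFun j)

theorem orbitMap_tensorBasis (μ : Composition n)
    (w : ∀ j : Fin μ.length, Equiv.Perm (Fin (μ.blocksFun j))) :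
    orbitMap n (tensorToHecke μ (tensorBasis μ w)) = vec GroundRing (blockPerm μ w) := by
  rw [tensorBasis, Basis.piTensorProduct_apply]
  exact orbitMap_tensorToHecke μ _ _ fun j => orbitMap_heckeBasis _

theorem tensorToHecke_injective (μ : Composition n) : Function.Injective (tensorToHecke μ) := by
  have h : orbitMap n ∘ₗ (tensorToHecke μ).toLinearMap =
      Finsupp.lmapDomain GroundRing GroundRing (blockPerm μ) ∘ₗ (tensorBasis μ).repr := by
    refine (tensorBasis μ).ext fun w => ?_
    rw [LinearMap.comp_apply, AlgHom.toLinearMap_apply, orbitMap_tensorBasis]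
    simp [vec]
  have hinj : Function.Injective (orbitMap n ∘ₗ (tensorToHecke μ).toLinearMap) := by
    rw [h, LinearMap.coe_comp]
    exact (Finsupp.mapDomain_injective (blockPerm_injective μ)).comp
      (tensorBasis μ).repr.injective
  rw [LinearMap.coe_comp] at hinj
  exact hinj.of_comp

/-- The isomorphism `H_μ ≃ H_{μ_1} ⊗ ⋯ ⊗ H_{μ_k}`. -/
def youngEquiv (μ : Composition n) : youngHecke μ ≃ₐ[GroundRing] tensorHecke μ :=
  ((AlgEquiv.ofInjective _ (tensorToHecke_injective μ)).trans
    (Subalgebra.equivOfEq _ _ (tensorToHecke_range μ))).symm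

/-- Both sides go to `w⁻¹` under the orbit map, so the choice of reduced expressions is
immaterial. -/
theorem tensorToHecke_word (μ : Composition n)
    (w : ∀ j : Fin μ.length, Equiv.Perm (Fin (μ.blocksFun j)))
    (L : List (Fin (n - 1))) (M : ∀ j : Fin μ.length, List (Fin (μ.blocksFun j - 1)))
    (hL : IsReducedExpr (blockPerm μ w) L) (hM : ∀ j, IsReducedExpr (w j) (M j)) :
    tensorToHecke μ (PiTensorProduct.tprod GroundRing fun j => Hecke.word (M j)) =
      Hecke.word L := by
  refine orbitMap_injective ?_
  rw [orbitMap_word hL, orbitMap_tensorToHecke μ _ w⁻¹ fun j => orbitMap_word (hM j),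
    blockPerm_inv]

/-- The basis elements `h_w` span the Young Hecke algebra. -/
theorem youngHecke_le_span (μ : Composition n) :
    Subalgebra.toSubmodule (youngHecke μ) ≤ Submodule.span GroundRing
      {y | ∃ w ∈ youngSubgroup μ, ∃ L, IsReducedExpr w L ∧ y = Hecke.word L} := by
  rw [← tensorToHecke_range]
  rintro _ ⟨t, rfl⟩
  have ht : t ∈ Submodule.span GroundRing (Set.range (tensorBasis μ)) := by
    rw [(tensorBasis μ).span_eq]; trivial
  rw [AlgHom.toRingHom_eq_coe, RingHom.coe_coe]
  induction ht using Submodule.span_induction with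
  | mem t ht =>
    obtain ⟨w, rfl⟩ := ht
    obtain ⟨L, hL⟩ := exists_isReducedExpr (blockPerm μ w⁻¹)
    refine Submodule.subset_span ⟨_, blockPerm_mem μ _, L, hL, orbitMap_injective ?_⟩
    rw [orbitMap_tensorBasis, orbitMap_word hL, blockPerm_inv, inv_inv]
  | zero => rw [map_zero]; exact Submodule.zero_mem _
  | add s t _ _ hs ht => rw [map_add]; exact Submodule.add_mem _ hs ht
  | smul r t _ ht => rw [map_smul]; exact Submodule.smul_mem _ r ht

/-! ### Linear set partitions, ties and compositions -/

namespace LinearSetPartition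

open Classical in
/-- The set of `i` such that `i` and `i + 1` lie in the same block. -/
def ties (I : LinearSetPartition n) : Finset (Fin (n - 1)) :=
  Finset.univ.filter fun i => I.rel (left i) (right i)

theorem mem_ties {I : LinearSetPartition n} {i : Fin (n - 1)} :
    i ∈ I.ties ↔ I.rel (left i) (right i) := by
  simp [ties]

/-- Ties from `a` up to `b = a + d` chain together. -/
theorem rel_of_ties {I : LinearSetPartition n} (d : ℕ) :
    ∀ a b : Fin n, (b : ℕ) = a + d → (∀ i, a ≤ left i → right i ≤ b → i ∈ I.ties) →
      I.rel a b := by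
  induction d with
  | zero =>
    intro a b h _
    obtain rfl : b = a := Fin.ext h
    exact I.rel.refl b
  | succ d ih =>
    intro a b h hi
    let k : Fin (n - 1) := ⟨a + d, by omega⟩
    have hk : right k = b := Fin.ext (by simp [right, k]; omega)
    have h1 : I.rel a (left k) := ih a (left k) rfl fun i h1 h2 => hi i h1
      (h2.trans (hk ▸ (left_lt_right k).le))
    refine I.rel.trans h1 (hk ▸ mem_ties.1 (hi k ?_ hk.le))
    simp [Fin.le_def, left, k]

theorem rel_iff_ties {I : LinearSetPartition n} {a b : Fin n} (hab : a ≤ b) :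
    I.rel a b ↔ ∀ i, a ≤ left i → right i ≤ b → i ∈ I.ties := by
  constructor
  · intro h i h1 h2
    have hi := (left_lt_right i).le
    exact mem_ties.2 (I.rel.trans (I.rel.symm (I.convex a _ b h1 (hi.trans h2) h))
      (I.convex a _ b (h1.trans hi) h2 h))
  · exact rel_of_ties (b - a) a b (by omega)

theorem le_iff_ties {I J : LinearSetPartition n} : I ≤ J ↔ I.ties ⊆ J.ties := by
  constructor
  · exact fun h i hi => mem_ties.2 (h (mem_ties.1 hi))
  · intro h
    have key : ∀ a b, a ≤ b → I.rel a b → J.rel a b := fun a b hab hI =>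
      (rel_iff_ties hab).2 fun i h1 h2 => h ((rel_iff_ties hab).1 hI i h1 h2)
    intro a b hI
    rcases le_total a b with hab | hab
    · exact key a b hab hI
    · exact J.rel.symm (key b a hab (I.rel.symm hI))

theorem ties_injective : Function.Injective (ties : LinearSetPartition n → _) := fun _ _ h =>
  le_antisymm (le_iff_ties.2 h.subset) (le_iff_ties.2 h.symm.subset)

/-- The linear set partition into the consecutive intervals of a composition. -/
def ofComposition (c : Composition n) : LinearSetPartition n where
  rel := Setoid.ker c.index
  convex i j k hij hjk h := by
    have h : c.index i = c.index k := h
    have hj : j ∈ Set.range (c.embedding (c.index i)) := by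
      rw [c.mem_range_embedding_iff]
      exact ⟨(c.sizeUpTo_index_le i).trans hij,
        lt_of_le_of_lt hjk (h ▸ c.lt_sizeUpTo_index_succ k)⟩
    exact c.mem_range_embedding_iff'.1 hj

theorem ofComposition_rel {c : Composition n} {i j : Fin n} :
    (ofComposition c).rel i j ↔ c.index i = c.index j := Iff.rfl

/-- The least element of the `j`-th interval of a composition. -/
def firstOfBlock (c : Composition n) (j : Fin c.length) : Fin n :=
  c.embedding j ⟨0, c.one_le_blocksFun j⟩

theorem ofComposition_rel_firstOfBlock {c : Composition n} {j : Fin c.length} {k : Fin n} :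
    (ofComposition c).rel (firstOfBlock c j) k ↔ k ∈ Set.range (c.embedding j) := by
  rw [ofComposition_rel, firstOfBlock, c.index_embedding, c.mem_range_embedding_iff']

theorem firstOfBlock_le {c : Composition n} {j : Fin c.length} {k : Fin n}
    (h : (ofComposition c).rel (firstOfBlock c j) k) : firstOfBlock c j ≤ k := by
  obtain ⟨b, rfl⟩ := ofComposition_rel_firstOfBlock.1 h
  exact (c.embedding j).monotone (Fin.le_def.2 (Nat.zero_le _))

theorem isBlockMin_ofComposition {c : Composition n} {i : Fin n} :
    (ofComposition c).IsBlockMin i ↔ ∃ j, firstOfBlock c j = i := by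
  constructor
  · intro h
    refine ⟨c.index i, ?_⟩
    have hrel : (ofComposition c).rel (firstOfBlock c (c.index i)) i :=
      ofComposition_rel_firstOfBlock.2 (c.mem_range_embedding i)
    exact le_antisymm (firstOfBlock_le hrel) (h _ ((ofComposition c).rel.symm hrel))
  · rintro ⟨j, rfl⟩ k hk
    exact firstOfBlock_le hk

theorem firstOfBlock_strictMono (c : Composition n) : StrictMono (firstOfBlock c) := by
  intro j k hjk
  have h := sizeUpTo_add_le_of_lt c hjk
  have h' := c.one_le_blocksFun j
  rw [Fin.lt_def]
  simp only [firstOfBlock, c.coe_embedding]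
  omega

theorem type_ofComposition (c : Composition n) : (ofComposition c).type = c := by
  classical
  have hlist : (List.finRange n).filter (fun i => (ofComposition c).IsBlockMin i) =
      (List.finRange c.length).map (firstOfBlock c) := by
    refine List.Perm.eq_of_pairwise' (r := (· < ·)) ((List.pairwise_lt_finRange n).filter _)
      (List.Pairwise.map _ (fun _ _ h => firstOfBlock_strictMono c h)
        (List.pairwise_lt_finRange c.length)) ?_
    rw [List.perm_ext_iff_of_nodup ((List.nodup_finRange n).filter _)
      ((List.nodup_finRange _).map (firstOfBlock_strictMono c).injective)]
    intro i
    simp [isBlockMin_ofComposition]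
  refine Composition.ext ?_
  change (ofComposition c).blockSizes = c.blocks
  have hfun : (fun i => Nat.card {j // (ofComposition c).rel i j}) ∘ firstOfBlock c =
      c.blocksFun := by
    funext j
    have : {k | (ofComposition c).rel (firstOfBlock c j) k} = Set.range (c.embedding j) :=
      Set.ext fun k => ofComposition_rel_firstOfBlock
    change Nat.card {k | (ofComposition c).rel (firstOfBlock c j) k} = _
    rw [this, Nat.card_range_of_injective (c.embedding j).injective, Nat.card_fin]
  rw [blockSizes, ← c.ofFn_blocksFun, List.ofFn_eq_map, ← hfun, ← List.map_map, ← hlist]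

theorem card_le : Fintype.card (LinearSetPartition n) ≤ 2 ^ (n - 1) := by
  have := Fintype.card_le_of_injective _ (ties_injective (n := n))
  rwa [Fintype.card_finset, Fintype.card_fin] at this

theorem type_surjective : Function.Surjective (type : LinearSetPartition n → Composition n) :=
  fun c => ⟨_, type_ofComposition c⟩

theorem card_eq : Fintype.card (LinearSetPartition n) = 2 ^ (n - 1) :=
  le_antisymm card_le <| by
    rw [← composition_card]
    exact Fintype.card_le_of_surjective _ type_surjective

/-- A linear set partition is determined by its ties, so there are at most `2 ^ (n - 1)` of them, which
is the number of compositions, and every composition occurs. -/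
theorem type_bijective : Function.Bijective (type : LinearSetPartition n → Composition n) := by
  rw [Fintype.bijective_iff_surjective_and_card, card_eq, composition_card]
  exact ⟨type_surjective, rfl⟩

theorem ties_bijective : Function.Bijective (ties : LinearSetPartition n → _) := by
  rw [Fintype.bijective_iff_injective_and_card, card_eq, Fintype.card_finset, Fintype.card_fin]
  exact ⟨ties_injective, rfl⟩

theorem ofComposition_type (I : LinearSetPartition n) : ofComposition I.type = I :=
  type_bijective.1 (type_ofComposition _)

theorem simple_mem_youngSubgroup_type {I : LinearSetPartition n} {i : Fin (n - 1)} :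
    simple i ∈ youngSubgroup I.type ↔ i ∈ I.ties := by
  rw [simple_mem_youngSubgroup_iff, ← ofComposition_rel, ofComposition_type, mem_ties]

theorem exists_isBlockMin (I : LinearSetPartition n) (j : Fin n) :
    ∃ i, I.IsBlockMin i ∧ I.rel i j := by
  classical
  obtain ⟨i, hi, hle⟩ := Finset.exists_min_image
    (Finset.univ.filter (fun i => I.rel i j)) id ⟨j, by simp⟩
  simp only [Finset.mem_filter, Finset.mem_univ, true_and, id] at hi hle
  exact ⟨i, fun k hk => hle k (I.rel.trans (I.rel.symm hk) hi), hi⟩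

theorem not_isBlockMin_iff {I : LinearSetPartition n} {i : Fin n} :
    ¬ I.IsBlockMin i ↔ ∃ k ∈ I.ties, right k = i := by
  constructor
  · intro h
    simp only [IsBlockMin, not_forall, not_le] at h
    obtain ⟨j, hij, hji⟩ := h
    let k : Fin (n - 1) := ⟨i - 1, by omega⟩
    have hk : right k = i := Fin.ext (by simp only [right, k]; omega)
    refine ⟨k, (rel_iff_ties hji.le).1 (I.rel.symm hij) k ?_ hk.le, hk⟩
    rw [Fin.le_def]
    simp only [left, k]
    omega
  · rintro ⟨k, hk, rfl⟩ h
    exact (h _ (I.rel.symm (mem_ties.1 hk))).not_gt (left_lt_right k)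

/-- Every block has one least element, and the other elements are the `i + 1` for ties `i`. -/
theorem numBlocks_add_card_ties (I : LinearSetPartition n) : I.numBlocks + I.ties.card = n := by
  classical
  have hbij : Function.Bijective
      fun i : {i // I.IsBlockMin i} => (Quotient.mk I.rel i.1 : Quotient I.rel) := by
    constructor
    · rintro ⟨i, hi⟩ ⟨j, hj⟩ h
      have h : I.rel i j := Quotient.exact h
      exact Subtype.ext (le_antisymm (hi j h) (hj i (I.rel.symm h)))
    · intro q
      induction q using Quotient.inductionOn with
      | h j =>
        obtain ⟨i, hi, hij⟩ := I.exists_isBlockMin j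
        exact ⟨⟨i, hi⟩, Quotient.sound hij⟩
  have hcompl : (Finset.univ.filter fun i => I.IsBlockMin i)ᶜ = I.ties.image right := by
    ext i
    simp [not_isBlockMin_iff]
  have hright : Function.Injective (right : Fin (n - 1) → Fin n) := fun i j h => by
    have := congrArg Fin.val h
    simp only [right] at this
    exact Fin.ext (by omega)
  have h1 := Finset.card_add_card_compl (Finset.univ.filter fun i => I.IsBlockMin i)
  rw [hcompl, Finset.card_image_of_injective _ hright, Fintype.card_fin] at h1
  rw [numBlocks, ← Nat.card_eq_of_bijective _ hbij, Nat.card_eq_fintype_card, Fintype.card_subtype]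
  exact h1

theorem mobius_of_le {I J : LinearSetPartition n} (h : I ≤ J) :
    I.mobius J = (-1) ^ (J.ties \ I.ties).card := by
  have hI := I.numBlocks_add_card_ties
  have hJ := J.numBlocks_add_card_ties
  have hsub := le_iff_ties.1 h
  have hle := Finset.card_le_card hsub
  rw [mobius, if_pos h, Finset.card_sdiff_of_subset hsub]
  congr 1
  omega

end LinearSetPartition

/-! ### Generators of the tied-boxed Hecke algebra -/

namespace BHecke

/-- The quotient map from the free algebra to `bH_n(q)`. -/
def mk (n : ℕ) : FreeAlgebra GroundRing (Gen n) →ₐ[GroundRing] BHecke n :=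
  RingQuot.mkAlgHom GroundRing (BHeckeRel n)

theorem mk_freeE (i : Fin (n - 1)) : mk n (freeE i) = e i := rfl

theorem mk_freeZ (i : Fin (n - 1)) : mk n (freeZ i) = z i := rfl

theorem mk_rel {a b : FreeAlgebra GroundRing (Gen n)} (h : BHeckeRel n a b) :
    mk n a = mk n b :=
  RingQuot.mkAlgHom_rel GroundRing h

theorem mk_surjective : Function.Surjective (mk n) :=
  RingQuot.mkAlgHom_surjective GroundRing (BHeckeRel n)

theorem e_mul_self (i : Fin (n - 1)) : (e i * e i : BHecke n) = e i := by
  simpa only [map_mul, mk_freeE] using mk_rel (BHeckeRel.e_idem i)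

theorem e_comm (i j : Fin (n - 1)) : (e i * e j : BHecke n) = e j * e i := by
  simpa only [map_mul, mk_freeE] using mk_rel (BHeckeRel.e_comm i j)

theorem z_braid {i j : Fin (n - 1)} (h : (i : ℕ) + 1 = j) :
    (z i * z j * z i : BHecke n) = z j * z i * z j := by
  simpa only [map_mul, mk_freeZ] using mk_rel (BHeckeRel.braid i j (Or.inl h))

theorem z_comm {i j : Fin (n - 1)} (h : (i : ℕ) + 1 < j) :
    (z i * z j : BHecke n) = z j * z i := by
  simpa only [map_mul, mk_freeZ] using mk_rel (BHeckeRel.z_comm i j (Or.inl h))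

theorem e_mul_z (i : Fin (n - 1)) : (e i * z i : BHecke n) = z i := by
  simpa only [map_mul, mk_freeE, mk_freeZ] using mk_rel (BHeckeRel.absorb i)

theorem ez_comm (i j : Fin (n - 1)) : (e i * z j : BHecke n) = z j * e i := by
  simpa only [map_mul, mk_freeE, mk_freeZ] using mk_rel (BHeckeRel.ez_comm i j)

theorem z_quad (i : Fin (n - 1)) : (z i * z i : BHecke n) = e i + qDiff • z i := by
  simpa only [map_mul, map_add, map_smul, mk_freeE, mk_freeZ] using mk_rel (BHeckeRel.quad i)

theorem adjoin_generators :
    Algebra.adjoin GroundRing (Set.range (e : Fin (n - 1) → BHecke n) ∪ Set.range z) = ⊤ := by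
  have h1 : Set.range (e : Fin (n - 1) → BHecke n) ∪ Set.range z =
      mk n '' Set.range (FreeAlgebra.ι GroundRing) := by
    rw [← Set.range_comp]
    ext y
    constructor
    · rintro (⟨i, rfl⟩ | ⟨i, rfl⟩)
      · exact ⟨Gen.e i, rfl⟩
      · exact ⟨Gen.z i, rfl⟩
    · rintro ⟨i | i, rfl⟩
      · exact Or.inl ⟨i, rfl⟩
      · exact Or.inr ⟨i, rfl⟩
  rw [h1, ← AlgHom.map_adjoin, FreeAlgebra.adjoin_range_ι, Algebra.map_top, AlgHom.range_eq_top]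
  exact mk_surjective

/-- A subalgebra that contains the generators contains everything. -/
theorem mem_of_generators (T : Subalgebra GroundRing (BHecke n)) (he : ∀ i, e i ∈ T)
    (hz : ∀ i, z i ∈ T) (x : BHecke n) : x ∈ T := by
  have : (⊤ : Subalgebra GroundRing (BHecke n)) ≤ T := by
    rw [← adjoin_generators, Algebra.adjoin_le_iff]
    rintro _ (⟨i, rfl⟩ | ⟨i, rfl⟩)
    · exact he i
    · exact hz i
  exact this trivial

theorem e_mem_center (i : Fin (n - 1)) : e i ∈ Subalgebra.center GroundRing (BHecke n) := by
  rw [Subalgebra.mem_center_iff]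
  intro x
  have := mem_of_generators (Subalgebra.centralizer GroundRing {e i})
    (fun j => by
      rw [Subalgebra.mem_centralizer_iff]
      rintro _ rfl
      exact e_comm i j)
    (fun j => by
      rw [Subalgebra.mem_centralizer_iff]
      rintro _ rfl
      exact ez_comm i j) x
  rw [Subalgebra.mem_centralizer_iff] at this
  exact (this _ rfl).symm

/-- The generator `e_i` as an element of the center. -/
def centralE (i : Fin (n - 1)) : Subalgebra.center GroundRing (BHecke n) := ⟨e i, e_mem_center i⟩

theorem centralE_mul_self (i : Fin (n - 1)) :
    (centralE i * centralE i : Subalgebra.center GroundRing (BHecke n)) = centralE i :=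
  Subtype.ext (e_mul_self i)

open Classical in
/-- The homomorphism `bH_n → H_n` that kills the `e_i` and `z_i` with `i ∉ A` and sends the other
`e_i` to `1` and the other `z_i` to `h_i`. -/
def toHecke (A : Finset (Fin (n - 1))) : BHecke n →ₐ[GroundRing] Hecke n :=
  RingQuot.liftAlgHom GroundRing ⟨FreeAlgebra.lift GroundRing fun g => match g with
    | Gen.e i => if i ∈ A then 1 else 0
    | Gen.z i => if i ∈ A then Hecke.h i else 0, by
    intro a b hab
    induction hab with
    | e_idem i =>
      simp only [freeE, map_mul, FreeAlgebra.lift_ι_apply]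
      split_ifs <;> simp
    | e_comm i j =>
      simp only [freeE, map_mul, FreeAlgebra.lift_ι_apply]
      split_ifs <;> simp
    | braid i j h =>
      simp only [freeZ, map_mul, FreeAlgebra.lift_ι_apply]
      split_ifs
      · exact h.elim Hecke.h_braid fun h => (Hecke.h_braid h).symm
      all_goals simp
    | z_comm i j h =>
      simp only [freeZ, map_mul, FreeAlgebra.lift_ι_apply]
      split_ifs
      · exact h.elim Hecke.h_comm fun h => (Hecke.h_comm h).symm
      all_goals simp
    | absorb i =>
      simp only [freeE, freeZ, map_mul, FreeAlgebra.lift_ι_apply]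
      split_ifs <;> simp
    | ez_comm i j =>
      simp only [freeE, freeZ, map_mul, FreeAlgebra.lift_ι_apply]
      split_ifs <;> simp
    | quad i =>
      simp only [freeE, freeZ, map_mul, map_add, map_smul, FreeAlgebra.lift_ι_apply]
      split_ifs
      · exact Hecke.h_quad i
      · simp⟩

open Classical in
theorem toHecke_e (A : Finset (Fin (n - 1))) (i : Fin (n - 1)) :
    toHecke A (e i) = if i ∈ A then 1 else 0 := by
  unfold toHecke e
  erw [RingQuot.liftAlgHom_mkAlgHom_apply]
  exact FreeAlgebra.lift_ι_apply _ _

open Classical in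
theorem toHecke_z (A : Finset (Fin (n - 1))) (i : Fin (n - 1)) :
    toHecke A (z i) = if i ∈ A then Hecke.h i else 0 := by
  unfold toHecke z
  erw [RingQuot.liftAlgHom_mkAlgHom_apply]
  exact FreeAlgebra.lift_ι_apply _ _

theorem toHecke_word {A : Finset (Fin (n - 1))} {L : List (Fin (n - 1))} (h : ∀ i ∈ L, i ∈ A) :
    toHecke A (word L) = Hecke.word L := by
  rw [word, Hecke.word, map_list_prod, List.map_map]
  congr 1
  refine List.map_congr_left fun i hi => ?_
  rw [Function.comp_apply, toHecke_z, if_pos (h i hi)]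

end BHecke

/-! ### The Möbius idempotents -/

section CommutingIdempotents

variable {ι C : Type*} [Fintype ι] [DecidableEq ι] [CommRing C] (ε : ι → C)

/-- The product of `ε i` over `A` and of `1 - ε i` over the complement of `A`. -/
def signedProd (A : Finset ι) : C := ∏ i, if i ∈ A then ε i else 1 - ε i

theorem signedProd_eq (A : Finset ι) :
    signedProd ε A = (∏ i ∈ A, ε i) * ∏ i ∈ Finset.univ \ A, (1 - ε i) := by
  rw [signedProd, Finset.prod_ite]
  congr 2 <;> ext <;> simp

theorem signedProd_eq_sum (A : Finset ι) :
    signedProd ε A = ∑ T ∈ Aᶜ.powerset, ((-1) ^ T.card : ℤ) • ∏ i ∈ A ∪ T, ε i := by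
  rw [signedProd_eq, ← Finset.compl_eq_univ_sdiff]
  simp only [sub_eq_add_neg, Finset.prod_one_add, Finset.prod_neg, Finset.mul_sum]
  refine Finset.sum_congr rfl fun T hT => ?_
  rw [Finset.prod_union (disjoint_compl_right.mono_right (Finset.mem_powerset.1 hT)),
    zsmul_eq_mul]
  push_cast
  ring

theorem mul_signedProd (hε : ∀ i, ε i * ε i = ε i) (A : Finset ι) (i : ι) :
    ε i * signedProd ε A = if i ∈ A then signedProd ε A else 0 := by
  rw [signedProd, ← Finset.mul_prod_erase _ _ (Finset.mem_univ i), ← mul_assoc]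
  split_ifs with hi
  · rw [hε]
  · rw [mul_sub, mul_one, hε, sub_self, zero_mul]

theorem sum_signedProd : ∑ A, signedProd ε A = 1 := by
  have h : (1 : C) = ∏ i, (ε i + (1 - ε i)) := by simp
  rw [h, Finset.prod_add, Finset.powerset_univ]
  exact Finset.sum_congr rfl fun A _ => signedProd_eq ε A

end CommutingIdempotents

namespace LinearSetPartition

open BHecke

theorem E_eq_prod (I : LinearSetPartition n) :
    I.E = ((∏ i ∈ I.ties, centralE i : Subalgebra.center GroundRing (BHecke n)) : BHecke n) := by
  classical
  have h : ((List.finRange (n - 1)).filter fun i => I.rel (left i) (right i)).toFinset =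
      I.ties := by
    ext i
    simp [mem_ties]
  rw [← h, List.prod_toFinset _ ((List.nodup_finRange _).filter _)]
  change _ = (Subalgebra.center GroundRing (BHecke n)).val _
  rw [map_list_prod, List.map_map]
  rfl

open Classical in
/-- The Möbius idempotent is the product of the `e_i` over the ties and of the `1 - e_i` over the
other `i`. -/
theorem idem_eq_signedProd (I : LinearSetPartition n) :
    I.idem = (signedProd (C := Subalgebra.center GroundRing (BHecke n)) centralE I.ties :
      BHecke n) := by
  rw [signedProd_eq_sum, idem]
  change _ = (Subalgebra.center GroundRing (BHecke n)).val _
  rw [map_sum]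
  refine Finset.sum_bij (fun J _ => J.ties \ I.ties) ?_ ?_ ?_ ?_
  · intro J _
    rw [Finset.mem_powerset, Finset.compl_eq_univ_sdiff]
    exact Finset.sdiff_subset_sdiff (Finset.subset_univ _) subset_rfl
  · intro J hJ K hK h
    have hJ := le_iff_ties.1 (Finset.mem_filter.1 hJ).2
    have hK := le_iff_ties.1 (Finset.mem_filter.1 hK).2
    refine ties_injective ?_
    rw [← Finset.sdiff_union_of_subset hJ, h, Finset.sdiff_union_of_subset hK]
  · intro T hT
    rw [Finset.mem_powerset] at hT
    obtain ⟨J, hJ⟩ := ties_bijective.2 (I.ties ∪ T)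
    refine ⟨J, ?_, ?_⟩
    · rw [Finset.mem_filter, le_iff_ties, hJ]
      exact ⟨Finset.mem_univ _, Finset.subset_union_left⟩
    · rw [hJ, Finset.union_sdiff_cancel_left (disjoint_compl_right.mono_right hT)]
  · intro J hJ
    have hle := (Finset.mem_filter.1 hJ).2
    rw [mobius_of_le hle, E_eq_prod, Finset.union_sdiff_of_subset (le_iff_ties.1 hle)]
    exact (map_zsmul (Subalgebra.center GroundRing (BHecke n)).val _ _).symm

theorem idem_mem_center (I : LinearSetPartition n) :
    I.idem ∈ Subalgebra.center GroundRing (BHecke n) := by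
  rw [idem_eq_signedProd]
  exact Subtype.property _

theorem idem_comm (I : LinearSetPartition n) (x : BHecke n) : I.idem * x = x * I.idem :=
  (Subalgebra.mem_center_iff.1 I.idem_mem_center x).symm

open Classical in
theorem e_mul_idem (I : LinearSetPartition n) (i : Fin (n - 1)) :
    e i * I.idem = if i ∈ I.ties then I.idem else 0 := by
  have h := congrArg (Subalgebra.center GroundRing (BHecke n)).val
    (mul_signedProd centralE centralE_mul_self I.ties i)
  rw [map_mul, apply_ite (Subalgebra.center GroundRing (BHecke n)).val, map_zero] at h
  rw [idem_eq_signedProd]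
  exact h

theorem idem_mul_e_of_mem {I : LinearSetPartition n} {i : Fin (n - 1)} (h : i ∈ I.ties) :
    I.idem * e i = I.idem := by
  rw [idem_comm, e_mul_idem, if_pos h]

theorem idem_mul_e_of_notMem {I : LinearSetPartition n} {i : Fin (n - 1)} (h : i ∉ I.ties) :
    I.idem * e i = 0 := by
  rw [idem_comm, e_mul_idem, if_neg h]

theorem idem_mul_z_of_notMem {I : LinearSetPartition n} {i : Fin (n - 1)} (h : i ∉ I.ties) :
    I.idem * z i = 0 := by
  rw [← e_mul_z, ← mul_assoc, idem_mul_e_of_notMem h, zero_mul]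

theorem sum_idem : ∑ I : LinearSetPartition n, I.idem = 1 := by
  classical
  have h := congrArg (Subalgebra.center GroundRing (BHecke n)).val
    (sum_signedProd (ι := Fin (n - 1)) (C := Subalgebra.center GroundRing (BHecke n)) centralE)
  rw [map_sum, map_one] at h
  rw [← h]
  exact Fintype.sum_bijective _ ties_bijective _ _ fun I => I.idem_eq_signedProd

theorem idem_mul_of_ne {I J : LinearSetPartition n} (h : I ≠ J) : I.idem * J.idem = 0 := by
  have key : ∀ {I J : LinearSetPartition n} (i), i ∈ I.ties → i ∉ J.ties →
      I.idem * J.idem = 0 := by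
    intro I J i hi hj
    rw [← idem_mul_e_of_mem hi, mul_assoc, ← idem_comm, idem_mul_e_of_notMem hj, mul_zero]
  by_cases hIJ : I.ties ⊆ J.ties
  · have hJI : ¬ J.ties ⊆ I.ties := fun h' => h (ties_injective (hIJ.antisymm h'))
    obtain ⟨i, hi, hi'⟩ := Finset.not_subset.1 hJI
    rw [idem_comm]
    exact key i hi hi'
  · obtain ⟨i, hi, hi'⟩ := Finset.not_subset.1 hIJ
    exact key i hi hi'

theorem idem_mul_self (I : LinearSetPartition n) : I.idem * I.idem = I.idem := by
  calc I.idem * I.idem = I.idem * ∑ J : LinearSetPartition n, J.idem := by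
        rw [Finset.mul_sum, Finset.sum_eq_single I (fun J _ h => idem_mul_of_ne h.symm) (by simp)]
    _ = I.idem := by rw [sum_idem, mul_one]

theorem completeOrthogonalIdempotents_idem :
    CompleteOrthogonalIdempotents (idem : LinearSetPartition n → BHecke n) where
  idem := idem_mul_self
  ortho _ _ h := idem_mul_of_ne h
  complete := sum_idem

/-! ### The summands -/

/-- The homomorphism `bH_n → H_n` attached to `I`. -/
def toHecke (I : LinearSetPartition n) : BHecke n →ₐ[GroundRing] Hecke n := BHecke.toHecke I.ties

theorem toHecke_E_self (I : LinearSetPartition n) : I.toHecke I.E = 1 := by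
  classical
  rw [E, map_list_prod]
  refine List.prod_eq_one fun x hx => ?_
  simp only [List.mem_map, List.mem_filter, decide_eq_true_eq] at hx
  obtain ⟨_, ⟨i, ⟨-, hi⟩, rfl⟩, rfl⟩ := hx
  rw [toHecke, toHecke_e, if_pos (mem_ties.2 hi)]

theorem toHecke_E_of_lt {I J : LinearSetPartition n} (h : I < J) : I.toHecke J.E = 0 := by
  classical
  have hJI : ¬ J.ties ⊆ I.ties := fun h' => h.not_ge (le_iff_ties.2 h')
  obtain ⟨i, hi, hi'⟩ := Finset.not_subset.1 hJI
  rw [E, map_list_prod]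
  refine List.prod_eq_zero ?_
  rw [List.map_map, List.mem_map]
  refine ⟨i, by simpa using mem_ties.1 hi, ?_⟩
  rw [Function.comp_apply, toHecke, toHecke_e, if_neg hi']

/-- Among the `E_J` with `J` coarser than `I` only `E_I` survives. -/
theorem toHecke_idem_self (I : LinearSetPartition n) : I.toHecke I.idem = 1 := by
  classical
  rw [idem, map_sum, Finset.sum_eq_single I]
  · rw [map_zsmul, toHecke_E_self, mobius_of_le le_rfl]
    simp
  · intro J hJ hne
    rw [map_zsmul, toHecke_E_of_lt (lt_of_le_of_ne (Finset.mem_filter.1 hJ).2 hne.symm), smul_zero]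
  · simp

theorem toHecke_idem_of_ne {I J : LinearSetPartition n} (h : J ≠ I) : I.toHecke J.idem = 0 := by
  rw [← mul_one (I.toHecke J.idem), ← toHecke_idem_self I, ← map_mul, idem_mul_of_ne h, map_zero]

theorem toHecke_idem_mul (I : LinearSetPartition n) (x : BHecke n) :
    I.toHecke (I.idem * x) = I.toHecke x := by
  rw [map_mul, toHecke_idem_self, one_mul]

theorem toHecke_mem (I : LinearSetPartition n) (x : BHecke n) :
    I.toHecke x ∈ youngHecke I.type := by
  classical
  refine mem_of_generators ((youngHecke I.type).comap I.toHecke) (fun i => ?_) (fun i => ?_) x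
  · rw [Subalgebra.mem_comap, toHecke, toHecke_e]
    split_ifs
    · exact one_mem _
    · exact zero_mem _
  · rw [Subalgebra.mem_comap, toHecke, toHecke_z]
    split_ifs with h
    · exact Algebra.subset_adjoin ⟨i, simple_mem_youngSubgroup_type.2 h, rfl⟩
    · exact zero_mem _

theorem T_one_mul_T_one :
    (LaurentPolynomial.T 1 * LaurentPolynomial.T 1 : GroundRing) =
      1 + qDiff * LaurentPolynomial.T 1 := by
  rw [qDiff, sub_mul, ← LaurentPolynomial.T_add, ← LaurentPolynomial.T_add]
  simp

/-- The generator `𝔼_I z_i` of the summand, extended to the complement by the scalar `q`, which is a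
root of `X² = 1 + (q - q⁻¹) X`. Thus the relations of the Hecke algebra hold with the unit of
`bH_n(q)` rather than that of the summand. -/
def extendedZ (I : LinearSetPartition n) (i : Fin (n - 1)) : BHecke n :=
  I.idem * z i + (LaurentPolynomial.T 1 : GroundRing) • (1 - I.idem)

theorem add_smul_compl_mul (I : LinearSetPartition n) (x y : BHecke n) (r s : GroundRing) :
    (I.idem * x + r • (1 - I.idem)) * (I.idem * y + s • (1 - I.idem)) =
      I.idem * (x * y) + (r * s) • (1 - I.idem) := by
  have h1 : I.idem * x * (I.idem * y) = I.idem * (x * y) := by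
    rw [mul_assoc, ← mul_assoc x, ← idem_comm, mul_assoc, ← mul_assoc, idem_mul_self]
  have h2 : (1 - I.idem) * (I.idem * y) = 0 := by
    rw [← mul_assoc, sub_mul, one_mul, idem_mul_self, sub_self, zero_mul]
  have h3 : I.idem * x * (1 - I.idem) = 0 := by
    rw [idem_comm, mul_assoc, mul_sub, mul_one, idem_mul_self, sub_self, mul_zero]
  have h4 : (1 - I.idem) * (1 - I.idem) = 1 - I.idem := by
    rw [mul_sub, mul_one, sub_mul, one_mul, idem_mul_self, sub_self, sub_zero]
  rw [add_mul, mul_add, mul_add, h1, mul_smul_comm, h3, smul_mul_assoc, h2, smul_mul_smul_comm, h4,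
    smul_zero, smul_zero, add_zero, zero_add]

theorem heckeFamily_extendedZ (I : LinearSetPartition n) :
    HeckeFamily {i | simple i ∈ youngSubgroup I.type} I.extendedZ where
  braid i _ j _ h := by
    simp only [extendedZ, add_smul_compl_mul, z_braid h]
  comm i _ j _ h := by
    simp only [extendedZ, add_smul_compl_mul, z_comm h]
  quad i hi := by
    rw [extendedZ, add_smul_compl_mul, z_quad, mul_add,
      idem_mul_e_of_mem (simple_mem_youngSubgroup_type.1 hi), mul_smul_comm, T_one_mul_T_one,
      smul_add, smul_smul, add_smul, one_smul]
    abel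

/-- The homomorphism `H_{μ_1} ⊗ ⋯ ⊗ H_{μ_k} → bH_n` whose product with `𝔼_I` maps onto the
summand. -/
def fromTensor (I : LinearSetPartition n) : tensorHecke I.type →ₐ[GroundRing] BHecke n :=
  tensorHom I.heckeFamily_extendedZ

theorem toHecke_fromTensor (I : LinearSetPartition n) (t : tensorHecke I.type) :
    I.toHecke (I.fromTensor t) = tensorToHecke I.type t := by
  classical
  refine DFunLike.congr_fun (map_tensorHom I.heckeFamily_extendedZ (heckeFamily_h _) I.toHecke
    fun i hi => ?_) t
  rw [extendedZ, map_add, toHecke_idem_mul, map_smul, map_sub, map_one, toHecke_idem_self, sub_self,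
    smul_zero, add_zero, toHecke, toHecke_z, if_pos (simple_mem_youngSubgroup_type.1 hi)]

/-- The `x` for which `𝔼_I x` comes from the tensor product form a subalgebra, since `𝔼_I` is a
central idempotent, and this subalgebra contains the generators. -/
theorem exists_idem_mul_fromTensor (I : LinearSetPartition n) (x : BHecke n) :
    ∃ t, I.idem * x = I.idem * I.fromTensor t := by
  let T : Subalgebra GroundRing (BHecke n) :=
    { carrier := {x | ∃ t, I.idem * x = I.idem * I.fromTensor t}
      mul_mem' := by
        rintro x y ⟨s, hs⟩ ⟨t, ht⟩
        refine ⟨s * t, ?_⟩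
        rw [map_mul, ← mul_assoc, hs, mul_assoc, idem_comm, mul_assoc, ← idem_comm, ht,
          ← mul_assoc, ← idem_comm, mul_assoc]
      add_mem' := by
        rintro x y ⟨s, hs⟩ ⟨t, ht⟩
        exact ⟨s + t, by rw [map_add, mul_add, mul_add, hs, ht]⟩
      algebraMap_mem' := fun r => ⟨algebraMap _ _ r, by rw [AlgHom.commutes]⟩ }
  refine mem_of_generators T (fun i => ?_) (fun i => ?_) x
  · by_cases hi : i ∈ I.ties
    · exact ⟨1, by rw [map_one, mul_one, idem_mul_e_of_mem hi]⟩
    · exact ⟨0, by rw [map_zero, mul_zero, idem_mul_e_of_notMem hi]⟩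
  · by_cases hi : i ∈ I.ties
    · have : I.extendedZ i ∈ I.fromTensor.range := by
        rw [fromTensor, tensorHom_range]
        exact Algebra.subset_adjoin ⟨i, simple_mem_youngSubgroup_type.2 hi, rfl⟩
      obtain ⟨t, ht⟩ := this
      refine ⟨t, ?_⟩
      have ht : I.fromTensor t = I.extendedZ i := ht
      rw [ht, extendedZ, mul_add, ← mul_assoc, idem_mul_self, mul_smul_comm, mul_sub, mul_one,
        idem_mul_self, sub_self, smul_zero, add_zero]
    · exact ⟨0, by rw [map_zero, mul_zero, idem_mul_z_of_notMem hi]⟩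

theorem idem_mul_eq_zero {I : LinearSetPartition n} {x : BHecke n} (h : I.toHecke x = 0) :
    I.idem * x = 0 := by
  obtain ⟨t, ht⟩ := I.exists_idem_mul_fromTensor x
  have h' : tensorToHecke I.type t = 0 := by
    rw [← toHecke_fromTensor, ← toHecke_idem_mul, ← ht, toHecke_idem_mul, h]
  rw [ht, (map_eq_zero_iff _ (tensorToHecke_injective _)).1 h', map_zero, mul_zero]

/-- The homomorphism attached to `I`, with values in the Young Hecke algebra. -/
def toYoungHecke (I : LinearSetPartition n) : BHecke n →ₐ[GroundRing] youngHecke I.type :=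
  I.toHecke.codRestrict _ I.toHecke_mem

theorem coe_toYoungHecke (I : LinearSetPartition n) (x : BHecke n) :
    (I.toYoungHecke x : Hecke n) = I.toHecke x := rfl

theorem toYoungHecke_surjective (I : LinearSetPartition n) :
    Function.Surjective I.toYoungHecke := by
  rintro ⟨y, hy⟩
  rw [← tensorToHecke_range] at hy
  obtain ⟨t, rfl⟩ := hy
  exact ⟨I.fromTensor t, Subtype.ext (I.toHecke_fromTensor t)⟩

/-- The linear map `𝔼_I bH_n → H_μ`. -/
def summandMap (I : LinearSetPartition n) : I.summand →ₗ[GroundRing] youngHecke I.type where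
  toFun y := I.toYoungHecke y
  map_add' x y := map_add I.toYoungHecke (x : BHecke n) y
  map_smul' r x := map_smul I.toYoungHecke r (x : BHecke n)

theorem summandMap_proj (I : LinearSetPartition n) (x : BHecke n) :
    I.summandMap (I.proj x) = I.toYoungHecke x :=
  Subtype.ext (I.toHecke_idem_mul x)

theorem summandMap_bijective (I : LinearSetPartition n) : Function.Bijective I.summandMap := by
  constructor
  · rw [injective_iff_map_eq_zero]
    rintro ⟨_, x, rfl⟩ h
    have h : I.summandMap (I.proj x) = 0 := h
    rw [summandMap_proj] at h
    exact Subtype.ext (idem_mul_eq_zero (congrArg Subtype.val h))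
  · intro y
    obtain ⟨x, rfl⟩ := I.toYoungHecke_surjective y
    exact ⟨I.proj x, I.summandMap_proj x⟩

/-- The isomorphism `𝔼_I bH_n ≃ H_μ`. -/
def summandEquiv (I : LinearSetPartition n) : I.summand ≃ₗ[GroundRing] youngHecke I.type :=
  LinearEquiv.ofBijective I.summandMap I.summandMap_bijective

theorem summandEquiv_proj (I : LinearSetPartition n) (x : BHecke n) :
    I.summandEquiv (I.proj x) = I.toYoungHecke x := I.summandMap_proj x

theorem summandEquiv_mul (I : LinearSetPartition n) (x y : I.summand) :
    I.summandEquiv (x * y) = I.summandEquiv x * I.summandEquiv y :=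
  map_mul I.toYoungHecke (x : BHecke n) y

end LinearSetPartition

/-! ### Images of reduced expressions -/

/-- Only letters in the Young subgroup occur in a reduced expression of one of its elements: a
letter outside cannot be added at an ascent without leaving the subgroup. -/
theorem IsReducedExpr.simple_mem {μ : Composition n} {w : Equiv.Perm (Fin n)}
    {L : List (Fin (n - 1))} (h : IsReducedExpr w L) (hw : w ∈ youngSubgroup μ) :
    ∀ i ∈ L, simple i ∈ youngSubgroup μ := by
  induction L generalizing w with
  | nil => simp
  | cons i L ih =>
    obtain ⟨h1, h2⟩ := h.of_cons
    have hi : simple i ∈ youngSubgroup μ := by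
      rw [simple_mem_youngSubgroup_iff]
      have hw' := (youngSubgroup μ).inv_mem hw
      have e : w⁻¹ = (permWord L)⁻¹ * simple i := by
        rw [← h.permWord_eq, permWord_cons, mul_inv_rev, simple_inv]
      have hl := hw' (left i)
      have hr := hw' (right i)
      rw [e, Equiv.Perm.mul_apply] at hl hr
      rw [simple_left] at hl
      rw [simple_right] at hr
      have hmono : ∀ a b : Fin n, a ≤ b → μ.index a ≤ μ.index b := by
        intro a b hab
        by_contra hlt
        have h1 := μ.sizeUpTo_index_le a
        have h2 := μ.lt_sizeUpTo_index_succ b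
        have h3 := μ.monotone_sizeUpTo
          (show (μ.index b).succ.val ≤ (μ.index a).val from not_le.1 hlt)
        have h4 : (a : ℕ) ≤ b := hab
        omega
      exact le_antisymm (hmono _ _ (left_lt_right i).le) (hl ▸ hr ▸ hmono _ _ h2.le)
    have hL : permWord L ∈ youngSubgroup μ := by
      rw [← h.permWord_eq, permWord_cons] at hw
      exact ((youngSubgroup μ).mul_mem_cancel_left hi).1 hw
    exact List.forall_mem_cons.2 ⟨hi, ih h1 hL⟩

namespace LinearSetPartition

theorem summandEquiv_word (I : LinearSetPartition n) {w : Equiv.Perm (Fin n)}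
    (hw : w ∈ youngSubgroup I.type) {L : List (Fin (n - 1))} (hL : IsReducedExpr w L) :
    (I.summandEquiv (I.proj (BHecke.word L)) : Hecke n) = Hecke.word L := by
  rw [summandEquiv_proj, coe_toYoungHecke, toHecke]
  exact BHecke.toHecke_word fun i hi => simple_mem_youngSubgroup_type.1 (hL.simple_mem hw i hi)

theorem span_proj_word (I : LinearSetPartition n) :
    Submodule.span GroundRing {y : I.summand | ∃ w ∈ youngSubgroup I.type, ∃ L,
      IsReducedExpr w L ∧ y = I.proj (BHecke.word L)} = ⊤ := by
  have hinj : Function.Injective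
      ((youngHecke I.type).val.toLinearMap ∘ₗ I.summandEquiv.toLinearMap) :=
    Subtype.val_injective.comp I.summandEquiv.injective
  rw [← top_le_iff]
  refine (Submodule.map_le_map_iff_of_injective hinj _ _).1 ?_
  rw [Submodule.map_span]
  rintro _ ⟨y, -, rfl⟩
  refine Submodule.span_mono ?_ (youngHecke_le_span I.type (I.summandEquiv y).2)
  rintro _ ⟨w, hw, L, hL, rfl⟩
  exact ⟨_, ⟨w, hw, L, hL, rfl⟩, I.summandEquiv_word hw hL⟩

theorem eq_summandEquiv (I : LinearSetPartition n)
    (f : I.summand →ₗ[GroundRing] youngHecke I.type)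
    (hf : ∀ w ∈ youngSubgroup I.type, ∀ L : List (Fin (n - 1)),
      IsReducedExpr w L → (f (I.proj (BHecke.word L)) : Hecke n) = Hecke.word L) :
    f = I.summandEquiv := by
  refine LinearMap.ext_on I.span_proj_word ?_
  rintro _ ⟨w, hw, L, hL, rfl⟩
  exact Subtype.ext ((hf w hw L hL).trans (I.summandEquiv_word hw hL).symm)

/-! ### Bases of the summands and the decomposition -/

/-- The basis of the summand that corresponds to the basis of the tensor product. -/
def summandBasis (I : LinearSetPartition n) :
    Module.Basis (∀ j : Fin I.type.length, Equiv.Perm (Fin (I.type.blocksFun j))) GroundRing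
      I.summand :=
  (tensorBasis I.type).map
    ((youngEquiv I.type).symm.toLinearEquiv.trans I.summandEquiv.symm)

theorem finrank_summand (I : LinearSetPartition n) :
    Module.finrank GroundRing I.summand = ∏ j, (I.type.blocksFun j)! := by
  rw [Module.finrank_eq_card_basis I.summandBasis, Fintype.card_pi]
  simp [Fintype.card_perm]

/-- The component at `μ` of the decomposition of `bH_n(q)`. As the Young Hecke algebra of `μ` and
that of the type of `ofComposition μ` agree only propositionally, an inclusion is inserted. -/
def component (μ : Composition n) : BHecke n →ₐ[GroundRing] tensorHecke μ :=
  ((youngEquiv μ).toAlgHom).comp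
    ((Subalgebra.inclusion (le_of_eq (by rw [type_ofComposition]))).comp
      (ofComposition μ).toYoungHecke)

theorem component_type (I : LinearSetPartition n) (x : BHecke n) :
    component I.type x = youngEquiv I.type (I.toYoungHecke x) := by
  rw [component]
  refine congrArg (youngEquiv I.type) (Subtype.ext ?_)
  change (ofComposition I.type).toHecke x = I.toHecke x
  rw [ofComposition_type]

/-- The homomorphism from `bH_n(q)` to the product of the tensor products. -/
def decomposition (n : ℕ) : BHecke n →ₐ[GroundRing] ∀ μ : Composition n, tensorHecke μ :=
  AlgHom.pi component

theorem decomposition_type (I : LinearSetPartition n) (x : BHecke n) :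
    decomposition n x I.type = youngEquiv I.type (I.toYoungHecke x) := component_type I x

theorem decomposition_bijective : Function.Bijective (decomposition n) := by
  constructor
  · rw [injective_iff_map_eq_zero]
    intro x hx
    rw [← one_mul x, ← sum_idem, Finset.sum_mul]
    refine Finset.sum_eq_zero fun I _ => idem_mul_eq_zero ?_
    have h := decomposition_type I x
    rw [hx, Pi.zero_apply] at h
    exact congrArg Subtype.val ((map_eq_zero_iff _ (youngEquiv I.type).injective).1 h.symm)
  · intro t
    choose y hy using fun I : LinearSetPartition n =>
      I.toYoungHecke_surjective ((youngEquiv I.type).symm (t I.type))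
    refine ⟨∑ I, I.idem * y I, funext fun μ => ?_⟩
    obtain ⟨I, rfl⟩ := type_surjective μ
    rw [decomposition_type, ← AlgEquiv.apply_symm_apply (youngEquiv I.type) (t I.type), ← hy]
    refine congrArg (youngEquiv I.type) (Subtype.ext ?_)
    rw [coe_toYoungHecke, coe_toYoungHecke, map_sum, Finset.sum_eq_single I]
    · rw [toHecke_idem_mul]
    · intro J _ hJ
      rw [map_mul, toHecke_idem_of_ne hJ, zero_mul]
    · simp

end LinearSetPartition

end TiedBoxed

end

open TiedBoxed in
theorem mainTheorem2 (n : ℕ) (hn : 0 < n) :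
    -- linear set partitions of `[n]` correspond to compositions of `n`
    Function.Bijective (LinearSetPartition.type : LinearSetPartition n → Composition n) ∧
    -- the Möbius idempotents are orthogonal, complete and central
    CompleteOrthogonalIdempotents (LinearSetPartition.idem : LinearSetPartition n → BHecke n) ∧
    (∀ (I : LinearSetPartition n) (x : BHecke n), I.idem * x = x * I.idem) ∧
    ∃ (Φ : ∀ I : LinearSetPartition n, I.summand ≃ₗ[GroundRing] youngHecke I.type)
      (Ψ : ∀ μ : Composition n, youngHecke μ ≃ₐ[GroundRing] tensorHecke μ)
      (Θ : BHecke n ≃ₐ[GroundRing] (∀ μ : Composition n, tensorHecke μ)),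
      -- `Φ I` is an isomorphism of algebras, where `𝔼_I` is the unit of `𝔼_I bH_n(q)`
      (∀ I : LinearSetPartition n, ∀ x y : I.summand, Φ I (x * y) = Φ I x * Φ I y) ∧
      (∀ I : LinearSetPartition n, Φ I (I.proj 1) = 1) ∧
      -- `Φ I` sends `𝔼_I z_w` to `h_w`, for each `w` in the Young subgroup
      (∀ I : LinearSetPartition n, ∀ w ∈ youngSubgroup I.type, ∀ L : List (Fin (n - 1)),
        IsReducedExpr w L → (Φ I (I.proj (BHecke.word L)) : Hecke n) = Hecke.word L) ∧
      -- and it is the only linear map that does so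
      (∀ I : LinearSetPartition n, ∀ Φ' : I.summand →ₗ[GroundRing] youngHecke I.type,
        (∀ w ∈ youngSubgroup I.type, ∀ L : List (Fin (n - 1)),
          IsReducedExpr w L → (Φ' (I.proj (BHecke.word L)) : Hecke n) = Hecke.word L) →
        Φ' = Φ I) ∧
      -- `Ψ μ` sends `h_w` to the tensor product of the `h_{w_j}`, for `w = w_1 ⋯ w_k`
      (∀ (μ : Composition n) (w : ∀ j : Fin μ.length, Equiv.Perm (Fin (μ.blocksFun j)))
        (L : List (Fin (n - 1))) (M : ∀ j : Fin μ.length, List (Fin (μ.blocksFun j - 1))),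
        IsReducedExpr (blockPerm μ w) L → (∀ j, IsReducedExpr (w j) (M j)) →
        ((Ψ μ).symm (PiTensorProduct.tprod GroundRing fun j => Hecke.word (M j)) : Hecke n)
          = Hecke.word L) ∧
      -- the summand is free of rank `μ_1! ⋯ μ_k!`
      (∀ I : LinearSetPartition n, Module.Free GroundRing I.summand ∧
        Module.finrank GroundRing I.summand = ∏ j, (I.type.blocksFun j)!) ∧
      -- the component of `Θ` at `‖I‖` is the projection to `𝔼_I bH_n(q)` followed by `Φ I`, `Ψ`
      (∀ (x : BHecke n) (I : LinearSetPartition n),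
        Θ x I.type = Ψ I.type (Φ I (I.proj x))) := by
  refine ⟨LinearSetPartition.type_bijective,
    LinearSetPartition.completeOrthogonalIdempotents_idem, LinearSetPartition.idem_comm,
    LinearSetPartition.summandEquiv, youngEquiv,
    AlgEquiv.ofBijective _ LinearSetPartition.decomposition_bijective,
    LinearSetPartition.summandEquiv_mul, fun I => ?_, fun I w hw L hL => I.summandEquiv_word hw hL,
    LinearSetPartition.eq_summandEquiv, tensorToHecke_word, fun I => ?_, fun x I => ?_⟩
  · rw [I.summandEquiv_proj, map_one]
  · exact ⟨Module.Free.of_basis I.summandBasis, I.finrank_summand⟩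
  · rw [I.summandEquiv_proj]
    exact I.decomposition_type x
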